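/- \textbf{Setting.} Let $E$ be a finite set and, for $i\in E$, let $F^i:\mathbb{R}^d\to\mathbb{R}^d$ be a bounded smooth vector field with flow $\Phi^i_t$. Let $M\subset\mathbb{R}^d$ be compact with $\Phi^i_t(M)\subset M$ for all $i\in E$, $t\ge 0$. For $x\in M$ and $i,j\in E$ let $\lambda(x,i,j)$ be continuous in $x$, with $\lambda(x,i,j)\ge 0$ for $i\ne j$, $\lambda(x,i,i)=0$, and $(\lambda(x,i,j))_{i,j}$ irreducible for each $x\in M$. Fix a constant $\lambda>0$ with $\sum_{j\ne i}\lambda(x,i,j)<\lambda$ for all $(x,i)\in M\times E$, and put $$Q(x,i,j)=\frac{\lambda(x,i,j)}{\lambda}\ (i\neq j),\qquad Q(x,i,i)=1-\sum_{j\ne i}Q(x,i,j).$$ On functions on $M\times E$ let $$Qg(x,i)=\sum_{j\in E}Q(x,i,j)\,g(x,j),\qquad K_tg(x,i)=g(\Phi^i_t(x),i),\qquad \tilde K g=\int_0^\infty \lambda e^{-\lambda t}K_tg\,dt,$$ and write $\mu Q$, $\mu\tilde K$ for the measures defined by duality. Let $U_1,U_2,\dots$ be i.i.d. exponential random variables of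 parameter $\lambda$ and $T_n=U_1+\dots+U_n$. The embedded chain $\tilde Z_n=(\tilde X_n,\tilde Y_n)$ on $M\times E$ is obtained by setting $\tilde X_{n+1}=\Phi^{\tilde Y_n}_{U_{n+1}}(\tilde X_n)$ and then drawing $\tilde Y_{n+1}$ from $Q(\tilde X_{n+1},\tilde Y_n,\cdot)$; let $\tilde P$ be its transition operator. The continuous-time process is $Z_t=(\Phi^{\tilde Y_n}_{t-T_n}(\tilde X_n),\tilde Y_n)$ for $T_n\le t<T_{n+1}$; let $(P_t)_{t\ge0}$ be its semigroup, $P_tg(x,i)=\mathbb{E}[g(Z_t)\mid Z_0=(x,i)]$. Let $\tilde{\mathcal P}_{inv}$ be the set of probability measures $\mu$ on $M\times E$ with $\mu\tilde P=\mu$, and $\mathcal P_{inv}$ the set of those with $\mu P_t=\mu$ for all $t\ge0$, both with the topology of weak convergence. A process is called stable if it has exactly one invariant probability measure. \textbf{Proposition (Correspondence for invariant measures).} The map $\mu\mapsto\mu\tilde K$ is a homeomorphism from $\tilde{\mathcal P}_{inv}$ onto $\mathcal P_{inv}$, and its inverse is the restriction of $\mu\mapsto\mu Q$ to $\mathcal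 P_{inv}$. It maps the set of extremal points of $\tilde{\mathcal P}_{inv}$ onto the set of extremal points of $\mathcal P_{inv}$. These extremal points are exactly the ergodic probabilities for $\tilde P$ and for $(P_t)$ respectively, that is, the invariant probabilities $\mu$ such that $\mu(A)\in\{0,1\}$ for every measurable $A$ with $\tilde P\mathbf 1_A=\mathbf 1_A$ $\mu$-almost everywhere (respectively, with $P_t\mathbf 1_A=\mathbf 1_A$ $\mu$-almost everywhere for every $t\ge0$). Consequently $(Z_t)$ is stable if and only if $(\tilde Z_n)$ is stable. -/

import Mathlib

open MeasureTheory ProbabilityTheory Set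
open scoped NNReal ENNReal ContDiff

namespace SwitchedPDMP

/-! ### Flows of vector fields on Euclidean space -/

section Flow

variable {d : ℕ}

open Classical in
/-- `flow F t x` is the value at time `t` of the solution of `x' = F x` started at `x` at time `0`.
For bounded smooth `F` the solution exists for all times, see `flow_spec`. -/
noncomputable def flow (F : EuclideanSpace ℝ (Fin d) → EuclideanSpace ℝ (Fin d)) (t : ℝ)
    (x : EuclideanSpace ℝ (Fin d)) : EuclideanSpace ℝ (Fin d) :=
  if h : ∃ γ : ℝ → EuclideanSpace ℝ (Fin d), γ 0 = x ∧ ∀ s, HasDerivAt γ (F (γ s)) s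
  then h.choose t else x

variable {F : EuclideanSpace ℝ (Fin d) → EuclideanSpace ℝ (Fin d)}

theorem exists_lipschitzOnWith_closedBall (hF : ContDiff ℝ ∞ F) (x : EuclideanSpace ℝ (Fin d))
    (r : ℝ) : ∃ K : ℝ≥0, LipschitzOnWith K F (Metric.closedBall x r) := by
  have hcont : Continuous (fderiv ℝ F) := hF.continuous_fderiv (by simp)
  obtain ⟨C, hC⟩ := (isCompact_closedBall x r).exists_bound_of_continuousOn hcont.continuousOn
  refine ⟨C.toNNReal, (convex_closedBall x r).lipschitzOnWith_of_nnnorm_fderiv_le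
    (fun y _ => hF.differentiable (by simp) y) (fun y hy => ?_)⟩
  rw [← NNReal.coe_le_coe]
  exact (hC y hy).trans (Real.le_coe_toNNReal C)

theorem exists_solution (hF : ContDiff ℝ ∞ F) {C : ℝ} (hC : ∀ x, ‖F x‖ ≤ C)
    (x : EuclideanSpace ℝ (Fin d)) :
    ∃ γ : ℝ → EuclideanSpace ℝ (Fin d), γ 0 = x ∧ ∀ s, HasDerivAt γ (F (γ s)) s := by
  have hF1 : ContDiff ℝ 1 F := hF.of_le (by simp)
  have key := (exists_isMIntegralCurve_iff_exists_isMIntegralCurveOn_Ioo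
    (I := modelWithCornersSelf ℝ (EuclideanSpace ℝ (Fin d))) (v := F)
    (contMDiff_vectorSpace_iff_contDiff.2 hF1) x).2 ?_
  · obtain ⟨γ, h0, h⟩ := key
    exact ⟨γ, h0, fun s => hasMFDerivAt_iff_hasFDerivAt.1 (h s)⟩
  · intro a
    have hC0 : 0 ≤ C := (norm_nonneg _).trans (hC x)
    rcases le_or_gt a 0 with ha | ha
    · refine ⟨fun _ => x, rfl, fun t ht => ?_⟩
      exact absurd (ht.1.trans ht.2) (by linarith)
    have h0 : (0 : ℝ) ∈ Icc (-a) a := ⟨by linarith, ha.le⟩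
    obtain ⟨K, hK⟩ := exists_lipschitzOnWith_closedBall hF x ((C * a).toNNReal : ℝ≥0)
    have hPL : IsPicardLindelof (fun _ => F) (⟨0, h0⟩ : Icc (-a) a) x (C * a).toNNReal 0
        C.toNNReal K :=
      { lipschitzOnWith := fun _ _ => hK
        continuousOn := fun _ _ => continuousOn_const
        norm_le := fun _ _ y _ => (hC y).trans (Real.le_coe_toNNReal C)
        mul_max_le := by
          have hCa : 0 ≤ C * a := mul_nonneg hC0 ha.le
          simp [hC0, hCa] }
    obtain ⟨γ, hγ0, hγ⟩ := hPL.exists_eq_forall_mem_Icc_hasDerivWithinAt₀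
    refine ⟨γ, hγ0, fun t ht => ?_⟩
    have h1 := (hγ t (Ioo_subset_Icc_self ht)).mono Ioo_subset_Icc_self
    exact hasMFDerivWithinAt_iff_hasFDerivWithinAt.2 h1

theorem flow_spec (hF : ContDiff ℝ ∞ F) {C : ℝ} (hC : ∀ x, ‖F x‖ ≤ C)
    (x : EuclideanSpace ℝ (Fin d)) :
    flow F 0 x = x ∧ ∀ s, HasDerivAt (fun t => flow F t x) (F (flow F s x)) s := by
  have h := exists_solution hF hC x
  have e : (fun t => flow F t x) = h.choose := by
    funext t; simp only [flow, dif_pos h]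
  have e' : ∀ t, flow F t x = h.choose t := fun t => congrFun e t
  refine ⟨by rw [e']; exact h.choose_spec.1, fun s => ?_⟩
  rw [e, e']
  exact h.choose_spec.2 s

/-- On a compact positively invariant set, the flow is jointly continuous in time and space. -/
theorem continuous_flow_restrict (hF : ContDiff ℝ ∞ F) {C : ℝ} (hC : ∀ x, ‖F x‖ ≤ C)
    {M : Set (EuclideanSpace ℝ (Fin d))} (hM : IsCompact M)
    (hinv : ∀ t, 0 ≤ t → ∀ x ∈ M, flow F t x ∈ M) :
    Continuous (fun p : M × ℝ≥0 => flow F p.2 (p.1 : EuclideanSpace ℝ (Fin d))) := by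
  obtain ⟨R, hR⟩ := hM.isBounded.subset_closedBall 0
  obtain ⟨K, hK⟩ := exists_lipschitzOnWith_closedBall hF 0 R
  have hKM := hK.mono hR
  have hd := fun x => (flow_spec hF hC x).2
  have h0 := fun x => (flow_spec hF hC x).1
  have hc : ∀ x, Continuous fun t => flow F t x := fun x =>
    continuous_iff_continuousAt.2 fun s => (hd x s).continuousAt
  refine continuous_prod_of_continuous_lipschitzWith' _ C.toNNReal (fun x => ?_) (fun t => ?_)
  · have h1 : LipschitzWith C.toNNReal fun t : ℝ => flow F t (x : EuclideanSpace ℝ (Fin d)) := by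
      refine lipschitzWith_of_nnnorm_deriv_le (𝕜 := ℝ) (fun s => (hd x s).differentiableAt)
        fun s => ?_
      rw [(hd x s).deriv, ← NNReal.coe_le_coe]
      exact (hC _).trans (Real.le_coe_toNNReal C)
    have h2 := h1.comp (isometry_subtype_coe (s := {r : ℝ | 0 ≤ r})).lipschitz
    rw [mul_one] at h2
    exact h2
  · have h1 : LipschitzWith (Real.exp (K * t)).toNNReal
        fun x : M => flow F t (x : EuclideanSpace ℝ (Fin d)) := by
      refine LipschitzWith.of_dist_le_mul fun x y => ?_
      have := dist_le_of_trajectories_ODE_of_mem (v := fun _ => F) (s := fun _ => M) (K := K)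
        (f := fun s => flow F s x) (g := fun s => flow F s y) (a := 0) (b := t)
        (δ := dist x y) (fun _ _ => hKM) (hc _).continuousOn
        (fun s _ => (hd x s).hasDerivWithinAt) (fun s hs => hinv s hs.1 x x.2) (hc _).continuousOn
        (fun s _ => (hd y s).hasDerivWithinAt) (fun s hs => hinv s hs.1 y y.2)
        (by simp only [h0]; exact le_rfl) t ⟨t.2, le_rfl⟩
      rw [sub_zero, mul_comm] at this
      rwa [Real.coe_toNNReal _ (Real.exp_pos _).le]
    exact h1.continuous

end Flow

/-! ### The data of the process -/

/-- The standing data: smooth bounded vector fields `F i`, a compact set `M` that is positively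
invariant under their flows, continuous jump rates `rate x i j` on `M`, irreducible at each point,
and a constant `lam` that strictly dominates all total jump rates. -/
structure System (d : ℕ) (E : Type*) [Fintype E] [DecidableEq E] where
  F : E → EuclideanSpace ℝ (Fin d) → EuclideanSpace ℝ (Fin d)
  smooth : ∀ i, ContDiff ℝ ∞ (F i)
  bounded : ∃ C : ℝ, ∀ i x, ‖F i x‖ ≤ C
  M : Set (EuclideanSpace ℝ (Fin d))
  isCompact : IsCompact M
  invariant : ∀ i, ∀ t : ℝ, 0 ≤ t → ∀ x ∈ M, flow (F i) t x ∈ M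
  rate : M → E → E → ℝ
  continuous_rate : ∀ i j, Continuous fun x => rate x i j
  rate_nonneg : ∀ x i j, i ≠ j → 0 ≤ rate x i j
  rate_self : ∀ x i, rate x i i = 0
  irreducible : ∀ x i j, Relation.ReflTransGen (fun a b => 0 < rate x a b) i j
  lam : ℝ
  lam_pos : 0 < lam
  sum_rate_lt : ∀ x i, ∑ j ∈ Finset.univ.erase i, rate x i j < lam

namespace System

variable {d : ℕ} {E : Type*} [Fintype E] [DecidableEq E] (S : System d E)

/-- The state space `M × E`. -/
abbrev State : Type _ := S.M × E

/-- The flow of the state: `(x, i)` is moved to `(Φ^i_t(x), i)`. -/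
noncomputable def move (z : S.State) (t : ℝ≥0) : S.State :=
  (⟨flow (S.F z.2) t z.1, S.invariant z.2 t t.2 z.1 z.1.2⟩, z.2)

/-- The transition matrix `Q(x) = (Q(x, i, j))`. -/
noncomputable def Qmat (x : S.M) (i j : E) : ℝ :=
  if i = j then 1 - ∑ k ∈ Finset.univ.erase i, S.rate x i k / S.lam else S.rate x i j / S.lam

theorem Qmat_nonneg (x : S.M) (i j : E) : 0 ≤ S.Qmat x i j := by
  unfold Qmat
  split_ifs with h
  · rw [← Finset.sum_div, sub_nonneg, div_le_one S.lam_pos]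
    exact (S.sum_rate_lt x i).le
  · exact div_nonneg (S.rate_nonneg x i j h) S.lam_pos.le

theorem sum_Qmat (x : S.M) (i : E) : ∑ j, S.Qmat x i j = 1 := by
  rw [← Finset.add_sum_erase _ _ (Finset.mem_univ i)]
  have : ∑ j ∈ Finset.univ.erase i, S.Qmat x i j
      = ∑ k ∈ Finset.univ.erase i, S.rate x i k / S.lam :=
    Finset.sum_congr rfl fun j hj => if_neg (Finset.ne_of_mem_erase hj).symm
  rw [this, Qmat, if_pos rfl]
  ring

theorem continuous_Qmat (i j : E) : Continuous fun x => S.Qmat x i j := by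
  unfold Qmat
  split_ifs
  · exact continuous_const.sub (continuous_finsetSum _ fun k _ => (S.continuous_rate i k).div_const _)
  · exact (S.continuous_rate i j).div_const _

/-- The law of the interarrival times: exponential of parameter `lam`, on `[0, ∞)`. -/
noncomputable def expLaw : Measure ℝ≥0 := (expMeasure S.lam).map Real.toNNReal

instance : IsProbabilityMeasure S.expLaw :=
  have := isProbabilityMeasure_expMeasure S.lam_pos
  Measure.isProbabilityMeasure_map measurable_real_toNNReal.aemeasurable

variable [MeasurableSpace E] [DiscreteMeasurableSpace E]

theorem measurable_move : Measurable fun p : S.State × ℝ≥0 => S.move p.1 p.2 := by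
  obtain ⟨C, hC⟩ := S.bounded
  have h : Measurable fun p : (S.M × ℝ≥0) × E =>
      flow (S.F p.2) p.1.2 (p.1.1 : EuclideanSpace ℝ (Fin d)) :=
    measurable_from_prod_countable_left fun i =>
      (continuous_flow_restrict (S.smooth i) (hC i) S.isCompact (S.invariant i)).measurable
  have h' : Measurable fun p : S.State × ℝ≥0 => ((p.1.1, p.2), p.1.2) := by fun_prop
  exact ((h.comp h').subtype_mk).prodMk (measurable_snd.comp measurable_fst)

/-- The Markov kernel `Q`: the position is kept, the index is redrawn from the matrix `Q(x)`. -/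
noncomputable def Q : Kernel S.State S.State where
  toFun z := ∑ j, ENNReal.ofReal (S.Qmat z.1 z.2 j) • Measure.dirac (z.1, j)
  measurable' := by
    refine Measure.measurable_of_measurable_coe _ fun A hA => ?_
    simp only [Measure.coe_finsetSum, Finset.sum_apply, Measure.smul_apply, smul_eq_mul]
    refine Finset.measurable_fun_sum _ fun j _ => Measurable.mul ?_ ?_
    · exact measurable_from_prod_countable_left fun i =>
        ENNReal.measurable_ofReal.comp (S.continuous_Qmat i j).measurable
    · have : Measurable fun z : S.State => (z.1, j) := by fun_prop
      exact (Measure.measurable_coe hA).comp (Measure.measurable_dirac.comp this)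

theorem Q_apply (z : S.State) :
    S.Q z = ∑ j, ENNReal.ofReal (S.Qmat z.1 z.2 j) • Measure.dirac (z.1, j) := rfl

instance : IsMarkovKernel S.Q := by
  refine ⟨fun z => ⟨?_⟩⟩
  rw [Q_apply]
  simp only [Measure.coe_finsetSum, Finset.sum_apply, Measure.smul_apply, measure_univ,
    smul_eq_mul, mul_one]
  rw [← ENNReal.ofReal_sum_of_nonneg fun j _ => S.Qmat_nonneg _ _ _, sum_Qmat, ENNReal.ofReal_one]

/-- From `z`, draw an exponential time `U` and return the pair `(move z U, U)`. -/
noncomputable def moveExp : Kernel S.State (S.State × ℝ≥0) :=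
  (Kernel.id ×ₖ Kernel.const S.State S.expLaw).map fun p => (S.move p.1 p.2, p.2)

instance : IsMarkovKernel S.moveExp :=
  Kernel.IsMarkovKernel.map _ (S.measurable_move.prodMk measurable_snd)

/-- The kernel `K̃ = ∫ lam * exp (-lam * t) K_t dt`: follow the flow for an exponential time. -/
noncomputable def Ktilde : Kernel S.State S.State := S.moveExp.map Prod.fst

instance : IsMarkovKernel S.Ktilde := Kernel.IsMarkovKernel.map _ measurable_fst

/-! ### The embedded chain and the continuous time process -/

/-- One step of the construction: from `z`, draw an exponential time `U`, follow the flow for the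
time `U`, redraw the index according to `Q`; the outcome is the new state together with `U`. -/
noncomputable def step : Kernel S.State (S.State × ℝ≥0) :=
  (S.Q ∥ₖ Kernel.id) ∘ₖ S.moveExp

instance : IsMarkovKernel S.step := by unfold step; infer_instance

/-- The transition kernel of the embedded chain. -/
noncomputable def Ptilde : Kernel S.State S.State := S.step.map Prod.fst

instance : IsMarkovKernel S.Ptilde := Kernel.IsMarkovKernel.map _ measurable_fst

/-- A path `n ↦ (Z̃_n, U_n)`: states of the embedded chain and interarrival times, `U_0` unused. -/
abbrev Path : Type _ := ℕ → S.State × ℝ≥0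

/-- The step kernel, seen as a function of the past of the path up to time `n`. -/
noncomputable def stepKernel (n : ℕ) :
    Kernel ((i : Finset.Iic n) → (fun _ : ℕ => S.State × ℝ≥0) i) (S.State × ℝ≥0) :=
  S.step.comap (fun h => (h ⟨n, Finset.mem_Iic.2 le_rfl⟩).1) (by fun_prop)

instance (n : ℕ) : IsMarkovKernel (S.stepKernel n) := by unfold stepKernel; infer_instance

/-- The law of the path `(Z̃_n, U_n)_n`, as a kernel in the initial state `Z̃_0`. -/
noncomputable def pathLaw : Kernel S.State S.Path :=
  (Kernel.traj (X := fun _ : ℕ => S.State × ℝ≥0) S.stepKernel 0).comap (fun z _ => (z, 0))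
    (by fun_prop)

instance : IsMarkovKernel S.pathLaw := by unfold pathLaw; infer_instance

/-- The jump times `T_n = U_1 + ... + U_n`. -/
def jumpTime (n : ℕ) (w : S.Path) : ℝ≥0 := ∑ k ∈ Finset.range n, (w (k + 1)).2

/-- The counting process `N_t`: the index `n` with `T_n ≤ t < T_{n+1}`. -/
noncomputable def count (t : ℝ≥0) (w : S.Path) : ℕ := sInf {n | t < S.jumpTime (n + 1) w}

/-- The continuous time process: `Z_t = (Φ^i_{t - T_n}(x), i)` for `T_n ≤ t < T_{n+1}`,
where `(x, i) = Z̃_n`. -/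
noncomputable def Z (t : ℝ≥0) (w : S.Path) : S.State :=
  S.move (w (S.count t w)).1 (t - S.jumpTime (S.count t w) w)

theorem measurable_jumpTime (n : ℕ) : Measurable (S.jumpTime n) := by
  unfold jumpTime; fun_prop

theorem measurable_count (t : ℝ≥0) : Measurable (S.count t) := by
  have hm : ∀ n, MeasurableSet {w : S.Path | t < S.jumpTime (n + 1) w} := fun n =>
    measurableSet_lt measurable_const (S.measurable_jumpTime _)
  refine measurable_to_countable' fun k => ?_
  have : S.count t ⁻¹' {k} =
      ({w | t < S.jumpTime (k + 1) w} ∩ ⋂ j ∈ Finset.range k, {w | t < S.jumpTime (j + 1) w}ᶜ) ∪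
      ({_w : S.Path | k = 0} ∩ ⋂ j, {w | t < S.jumpTime (j + 1) w}ᶜ) := by
    ext w
    simp only [count, mem_preimage, mem_singleton_iff, mem_union, mem_inter_iff, mem_ofPred_eq,
      mem_iInter, Finset.mem_range, mem_compl_iff]
    constructor
    · rintro rfl
      by_cases hne : {n | t < S.jumpTime (n + 1) w}.Nonempty
      · exact Or.inl ⟨Nat.sInf_mem hne, fun j hj => Nat.notMem_of_lt_sInf hj⟩
      · rw [not_nonempty_iff_eq_empty] at hne
        refine Or.inr ⟨by rw [hne, Nat.sInf_empty], fun j hj => ?_⟩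
        exact (hne ▸ (show j ∈ {n | t < S.jumpTime (n + 1) w} from hj) : j ∈ (∅ : Set ℕ))
    · rintro (⟨h1, h2⟩ | ⟨h1, h2⟩)
      · refine le_antisymm (Nat.sInf_le h1) (not_lt.1 fun hlt => ?_)
        exact h2 _ hlt (Nat.sInf_mem (s := {n | t < S.jumpTime (n + 1) w}) ⟨k, h1⟩)
      · have : {n | t < S.jumpTime (n + 1) w} = ∅ := eq_empty_of_forall_notMem h2
        rw [this, Nat.sInf_empty, h1]
  rw [this]
  refine MeasurableSet.union ((hm k).inter ?_) ((MeasurableSet.const _).inter ?_)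
  · exact Finset.measurableSet_biInter _ fun j _ => (hm j).compl
  · exact MeasurableSet.iInter fun j => (hm j).compl

theorem measurable_Z (t : ℝ≥0) : Measurable (S.Z t) := by
  have h : Measurable fun p : S.Path × ℕ => S.move (p.1 p.2).1 (t - S.jumpTime p.2 p.1) :=
    measurable_from_prod_countable_left fun n => S.measurable_move.comp
      ((measurable_pi_apply n).fst.prodMk (measurable_const.sub (S.measurable_jumpTime n)))
  exact h.comp (measurable_id.prodMk (S.measurable_count t))

/-- The semigroup of the process: `P t z` is the law of `Z_t` when the process starts at `z`. -/
noncomputable def P (t : ℝ≥0) : Kernel S.State S.State := S.pathLaw.map (S.Z t)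

instance (t : ℝ≥0) : IsMarkovKernel (S.P t) := Kernel.IsMarkovKernel.map _ (S.measurable_Z t)

end System

/-! ### Invariant, extremal and ergodic probabilities of a family of Markov kernels -/

section Invariant

variable {Ω : Type*} [MeasurableSpace Ω] {ι : Type*}

/-- The probability measures that are invariant under every kernel of the family. -/
def invariantProbs (κ : ι → Kernel Ω Ω) : Set (ProbabilityMeasure Ω) :=
  {μ | ∀ t, (κ t).Invariant (μ : Measure Ω)}

/-- The extremal points of a set of probability measures, seen inside the space of measures. -/
def extremalProbs (A : Set (ProbabilityMeasure Ω)) : Set (ProbabilityMeasure Ω) :=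
  {μ | (μ : Measure Ω) ∈ Set.extremePoints ℝ≥0 ((fun ν : ProbabilityMeasure Ω => (ν : Measure Ω)) '' A)}

/-- The ergodic probabilities: invariant, and giving measure `0` or `1` to each measurable set `A`
that is almost surely invariant, i.e. `κ t 1_A = 1_A` almost everywhere for all `t`. -/
def ergodicProbs (κ : ι → Kernel Ω Ω) : Set (ProbabilityMeasure Ω) :=
  {μ | μ ∈ invariantProbs κ ∧ ∀ A : Set Ω, MeasurableSet A →
    (∀ t, (fun z => κ t z A) =ᵐ[(μ : Measure Ω)] A.indicator 1) →
    (μ : Measure Ω) A = 0 ∨ (μ : Measure Ω) A = 1}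

/-- The image `μ κ` of a probability measure under a Markov kernel. -/
noncomputable def act (κ : Kernel Ω Ω) [IsMarkovKernel κ] (μ : ProbabilityMeasure Ω) :
    ProbabilityMeasure Ω :=
  ⟨(μ : Measure Ω).bind κ, inferInstance⟩

end Invariant

namespace System

variable {d : ℕ} {E : Type*} [Fintype E] [DecidableEq E] [MeasurableSpace E]
  [DiscreteMeasurableSpace E] (S : System d E)

/-- The invariant probabilities of the embedded chain. -/
def invChain : Set (ProbabilityMeasure S.State) := invariantProbs fun _ : Unit => S.Ptilde

/-- The invariant probabilities of the continuous time process. -/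
def invSemigroup : Set (ProbabilityMeasure S.State) := invariantProbs S.P

end System

/-- A process is stable if it has a unique invariant probability. -/
def Stable {Ω : Type*} [MeasurableSpace Ω] (I : Set (ProbabilityMeasure Ω)) : Prop :=
  ∃! μ, μ ∈ I

end SwitchedPDMP

namespace SwitchedPDMP

/-! ### Invariant, extremal and ergodic probabilities of Markov kernels. -/

section General

variable {Ω : Type*} [MeasurableSpace Ω] {ι : Type*}

/-! One step of the chain is "flow, then redraw", so `μ P̃ = (μ K̃) Q` (`Ptilde_eq_comp`), and
invariance for the chain reads `μ K̃ Q = μ`. The heart of the proof is the twin statement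
`mem_invSemigroup_iff`: `ν` is invariant for `(P_t)` iff `ν Q K̃ = ν`. Granted both, `K̃` and `Q`
are mutually inverse between the two sets by pure algebra. Both act continuously (Feller property)
and affinely, hence give a homeomorphism preserving extremal points, and uniqueness transfers.

The twin statement is proved without generators. Let `a_n(t, g)` be the part of `E_ν g(Z_t)` with
exactly `n` jumps before `t` (`jumpTerm`). The jump times do not accumulate, so `ν P_t g = ∑ a_n(t,
g)` (`lintegral_bind_P_eq_tsum`). Also `a_0(t, g) = e^{-λt} ν K_t g`, and conditioning on the last
jump gives `a_{n+1}(t, g) = ∫_0^t λ e^{-λ(t-s)} a_n(s, Q K_{t-s} g) ds` (`jumpTerm_succ`). If `ν` is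
`P`-invariant, summing the recursion over `n` gives `∫_0^t λ e^{-λu} ν Q K_u g du ≤ ν g`, and `t →
∞` yields `ν Q K̃ ≤ ν`. If `ν Q K̃ = ν`, then `ν g` satisfies the same renewal equation as the full
sum, so by induction all partial sums of `a_n(t, g)` are at most `ν g` and `ν P_t ≤ ν`. Either way
the two sides are probabilities, so an inequality is already an equality.

That extremal means ergodic is a general fact about families of Markov kernels
(`extremalProbs_invariantProbs`). -/

theorem measure_eq_of_le_of_univ_eq {μ ν : Measure Ω} [IsFiniteMeasure μ] (h : μ ≤ ν)
    (huniv : μ univ = ν univ) : μ = ν := by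
  have : IsFiniteMeasure ν := ⟨huniv ▸ measure_lt_top μ univ⟩
  refine le_antisymm h (Measure.le_iff.2 fun A hA => ?_)
  have h1 := measure_add_measure_compl (μ := μ) hA
  have h2 := measure_add_measure_compl (μ := ν) hA
  have h3 : ν A + ν Aᶜ ≤ μ A + ν Aᶜ := by
    rw [h2, ← huniv, ← h1]
    exact add_le_add le_rfl (h _)
  exact (ENNReal.add_le_add_iff_right (measure_ne_top _ _)).1 h3

theorem bind_univ (κ : Kernel Ω Ω) [IsMarkovKernel κ] (μ : Measure Ω) :
    μ.bind κ univ = μ univ := by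
  rw [Measure.bind_apply MeasurableSet.univ κ.aemeasurable]
  simp

theorem bind_mono_measure (κ : Kernel Ω Ω) {μ ν : Measure Ω} (h : μ ≤ ν) :
    μ.bind κ ≤ ν.bind κ := by
  refine Measure.le_iff.2 fun A hA => ?_
  rw [Measure.bind_apply hA κ.aemeasurable, Measure.bind_apply hA κ.aemeasurable]
  exact lintegral_mono' h le_rfl

theorem bind_add_measure (κ : Kernel Ω Ω) (μ ν : Measure Ω) :
    (μ + ν).bind κ = μ.bind κ + ν.bind κ := by
  ext A hA
  rw [Measure.add_apply, Measure.bind_apply hA κ.aemeasurable, Measure.bind_apply hA κ.aemeasurable,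
    Measure.bind_apply hA κ.aemeasurable, lintegral_add_measure]

theorem bind_smul_measure (κ : Kernel Ω Ω) (c : ℝ≥0) (μ : Measure Ω) :
    (c • μ).bind κ = c • μ.bind κ := by
  ext A hA
  rw [Measure.smul_apply, Measure.bind_apply hA κ.aemeasurable,
    Measure.bind_apply hA κ.aemeasurable, lintegral_smul_measure]

theorem measure_left_cancel {ρ σ τ : Measure Ω} [IsFiniteMeasure ρ] (h : ρ + σ = ρ + τ) :
    σ = τ := by
  ext A _
  have := congrArg (fun m : Measure Ω => m A) h
  exact (ENNReal.add_right_inj (measure_ne_top ρ A)).1 this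

/-- The restriction of an invariant measure to an almost surely invariant set is invariant. -/
theorem bind_restrict_of_indicator (κ : Kernel Ω Ω) [IsMarkovKernel κ] {μ : Measure Ω}
    (hμ : μ.bind κ = μ) {A : Set Ω} (hA : MeasurableSet A)
    (h : (fun z => κ z A) =ᵐ[μ] A.indicator 1) : (μ.restrict A).bind κ = μ.restrict A := by
  ext B hB
  rw [Measure.bind_apply hB κ.aemeasurable, Measure.restrict_apply hB,
    ← lintegral_indicator hA]
  conv_rhs => rw [← hμ, Measure.bind_apply (hB.inter hA) κ.aemeasurable]
  refine lintegral_congr_ae ?_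
  filter_upwards [h] with z hz
  by_cases hzA : z ∈ A
  · rw [indicator_of_mem hzA] at hz ⊢
    exact (measure_inter_conull ((prob_compl_eq_zero_iff hA).2 hz)).symm
  · rw [indicator_of_notMem hzA] at hz ⊢
    exact (measure_mono_null inter_subset_right hz).symm

theorem indicator_compl_of_indicator (κ : Kernel Ω Ω) [IsMarkovKernel κ] {μ : Measure Ω}
    {A : Set Ω} (hA : MeasurableSet A)
    (h : (fun z => κ z A) =ᵐ[μ] A.indicator 1) :
    (fun z => κ z Aᶜ) =ᵐ[μ] Aᶜ.indicator 1 := by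
  filter_upwards [h] with z hz
  rw [prob_compl_eq_one_sub hA, hz]
  by_cases hzA : z ∈ A <;> simp [hzA]

/-- If `ν ≪ μ` are invariant probabilities, the set where the density of `ν` exceeds `1` is almost
surely invariant. -/
theorem indicator_rnDeriv_gt_one (κ : Kernel Ω Ω) [IsMarkovKernel κ] {μ ν : Measure Ω}
    [IsProbabilityMeasure μ] [IsProbabilityMeasure ν] (hμ : μ.bind κ = μ) (hν : ν.bind κ = ν)
    (hac : ν ≪ μ) :
    (fun z => κ z {x | 1 < ν.rnDeriv μ x}) =ᵐ[μ] {x | 1 < ν.rnDeriv μ x}.indicator 1 := by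
  set f := ν.rnDeriv μ with hf
  have hfm : Measurable f := Measure.measurable_rnDeriv ν μ
  set A : Set Ω := {x | 1 < f x} with hAdef
  have hA : MeasurableSet A := measurableSet_lt measurable_const hfm
  have hνf : μ.withDensity f = ν := Measure.withDensity_rnDeriv_eq ν μ hac
  -- `ρ` is the infimum of `μ` and `ν`, and `σ = ν - ρ`, as the truncated subtraction makes its
  -- density `(f - 1)⁺`. Both turn out to be invariant.
  set ρ := μ.withDensity (fun x => min (f x) 1) with hρ
  set σ := μ.withDensity (fun x => f x - 1) with hσ
  have hρν : ρ ≤ ν := by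
    rw [← hνf]
    exact withDensity_mono (.of_forall fun x => min_le_left _ _)
  have hρμ : ρ ≤ μ := by
    conv_rhs => rw [← withDensity_one (μ := μ)]
    exact withDensity_mono (.of_forall fun x => min_le_right _ _)
  have : IsFiniteMeasure ρ := isFiniteMeasure_of_le ν hρν
  have hsum : ρ + σ = ν := by
    rw [← hνf, hρ, hσ, ← withDensity_add_left (by fun_prop)]
    congr 1
    ext x
    rw [Pi.add_apply, add_comm, tsub_add_min]
  have hle : ρ.bind κ ≤ ρ := by
    have h1 : ρ.bind κ ≤ ν := (bind_mono_measure κ hρν).trans hν.le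
    have h2 : ρ.bind κ ≤ μ := (bind_mono_measure κ hρμ).trans hμ.le
    refine Measure.le_iff.2 fun B hB => ?_
    -- On `A` the minimum is `1`, so the bound by `μ` is the sharp one; off `A` it is `f`, and the
    -- bound by `ν` is.
    rw [← measure_inter_add_sdiff (μ := ρ.bind κ) B hA, ← measure_inter_add_sdiff (μ := ρ) B hA]
    refine add_le_add ((h2 _).trans ?_) ((h1 _).trans ?_)
    · rw [hρ, withDensity_apply _ (hB.inter hA), ← setLIntegral_one]
      refine setLIntegral_mono (by fun_prop) fun x hx => ?_
      exact le_min hx.2.le le_rfl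
    · rw [hρ, withDensity_apply _ (hB.diff hA), ← hνf, withDensity_apply _ (hB.diff hA)]
      refine setLIntegral_mono (by fun_prop) fun x hx => ?_
      exact le_min le_rfl (not_lt.1 hx.2)
  have : IsFiniteMeasure (ρ.bind κ) := isFiniteMeasure_of_le ρ hle
  have hρinv : ρ.bind κ = ρ := measure_eq_of_le_of_univ_eq hle (bind_univ κ ρ)
  have hσinv : σ.bind κ = σ := by
    refine measure_left_cancel (ρ := ρ) ?_
    conv_lhs => rw [← hρinv, ← bind_add_measure, hsum, hν, ← hsum]
  have hσA : σ Aᶜ = 0 := by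
    rw [hσ, withDensity_apply _ hA.compl, setLIntegral_eq_zero_iff hA.compl (by fun_prop)]
    exact .of_forall fun x hx => tsub_eq_zero_of_le (not_lt.1 hx)
  -- `σ` is invariant and lives on `A`, so it cannot leak into `Aᶜ`; its density is positive on `A`,
  -- which turns this into a statement about `μ`.
  have hAc : ∀ᵐ z ∂μ, z ∈ A → κ z Aᶜ = 0 := by
    have h1 : ∫⁻ z, κ z Aᶜ ∂σ = 0 := by
      rw [← Measure.bind_apply hA.compl κ.aemeasurable, hσinv, hσA]
    rw [hσ, lintegral_withDensity_eq_lintegral_mul _ (by fun_prop)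
      (κ.measurable_coe hA.compl), lintegral_eq_zero_iff
      (Measurable.mul (by fun_prop) (κ.measurable_coe hA.compl))] at h1
    filter_upwards [h1] with z hz hzA
    refine (mul_eq_zero.1 hz).resolve_left ?_
    exact (tsub_pos_of_lt hzA).ne'
  have hA1 : ∀ᵐ z ∂μ, z ∈ A → κ z A = 1 := by
    filter_upwards [hAc] with z hz hzA
    exact (prob_compl_eq_zero_iff hA).1 (hz hzA)
  have hA0 : ∀ᵐ z ∂μ, z ∈ Aᶜ → κ z A = 0 := by
    -- The points of `A` already contribute all of `μ A` to this integral, leaving nothing for `Aᶜ`.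
    have h1 : ∫⁻ z, κ z A ∂μ = μ A := by
      conv_rhs => rw [← hμ, Measure.bind_apply hA κ.aemeasurable]
    rw [← lintegral_add_compl _ hA, setLIntegral_congr_fun_ae hA hA1, setLIntegral_one] at h1
    have h2 : ∫⁻ z in Aᶜ, κ z A ∂μ = 0 := by
      refine (ENNReal.add_right_inj (measure_ne_top μ A)).1 ?_
      rw [h1, add_zero]
    exact (setLIntegral_eq_zero_iff hA.compl (κ.measurable_coe hA)).1 h2
  filter_upwards [hA0, hA1] with z h0 h1
  by_cases hzA : z ∈ A
  · simp [hzA, h1 hzA]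
  · simp [hzA, h0 hzA]

theorem mem_extremalProbs_iff {I : Set (ProbabilityMeasure Ω)} {μ : ProbabilityMeasure Ω} :
    μ ∈ extremalProbs I ↔ μ ∈ I ∧ ∀ ν₁ ∈ I, ∀ ν₂ ∈ I, ∀ a b : ℝ≥0, 0 < a → 0 < b → a + b = 1 →
      a • (ν₁ : Measure Ω) + b • (ν₂ : Measure Ω) = μ → ν₁ = μ := by
  have hinj : ∀ {α β : ProbabilityMeasure Ω}, (α : Measure Ω) = β → α = β :=
    fun h => Subtype.ext h
  constructor
  · rintro ⟨⟨μ', hμ', h⟩, h2⟩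
    obtain rfl := hinj h
    refine ⟨hμ', fun ν₁ h₁ ν₂ h₂ a b ha hb hab he => ?_⟩
    exact hinj (h2 ⟨ν₁, h₁, rfl⟩ ⟨ν₂, h₂, rfl⟩ ⟨a, b, ha, hb, hab, he⟩)
  · rintro ⟨h1, h2⟩
    refine ⟨⟨μ, h1, rfl⟩, ?_⟩
    rintro _ ⟨ν₁, h₁, rfl⟩ _ ⟨ν₂, h₂, rfl⟩ ⟨a, b, ha, hb, hab, he⟩
    exact congrArg _ (h2 ν₁ h₁ ν₂ h₂ a b ha hb hab he)

/-- The normalized restriction of a probability to a set of positive measure, seen as an invariant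
probability. -/
theorem exists_invariant_smul_eq_restrict (κ : ι → Kernel Ω Ω) [∀ t, IsMarkovKernel (κ t)]
    {μ : ProbabilityMeasure Ω} (hμ : μ ∈ invariantProbs κ) {A : Set Ω} (hA : MeasurableSet A)
    (h : ∀ t, (fun z => κ t z A) =ᵐ[(μ : Measure Ω)] A.indicator 1)
    (h0 : (μ : Measure Ω) A ≠ 0) :
    ∃ ν ∈ invariantProbs κ, μ A • (ν : Measure Ω) = (μ : Measure Ω).restrict A := by
  have hA0 : μ A ≠ 0 := fun hc => h0 (by rw [← ProbabilityMeasure.ennreal_coeFn_eq_coeFn_toMeasure, hc]; rfl)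
  refine ⟨⟨(μ A)⁻¹ • (μ : Measure Ω).restrict A, ⟨?_⟩⟩, fun t => ?_, ?_⟩
  · rw [Measure.smul_apply, Measure.restrict_apply_univ,
      ← ProbabilityMeasure.ennreal_coeFn_eq_coeFn_toMeasure, ENNReal.smul_def, smul_eq_mul,
      ENNReal.coe_inv hA0, ENNReal.inv_mul_cancel (by simpa using hA0) ENNReal.coe_ne_top]
  · change Measure.bind _ _ = _
    simp only [ProbabilityMeasure.coe_mk]
    rw [bind_smul_measure, bind_restrict_of_indicator (κ t) (hμ t) hA (h t)]
  · simp only [ProbabilityMeasure.coe_mk]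
    rw [smul_smul, mul_inv_cancel₀ hA0, one_smul]

/-- A nontrivial almost surely invariant set splits `μ` into two invariant pieces, by restriction.
Conversely, a component `ν₁` of an ergodic `μ` has a density `f`, and `{f > 1}` is almost surely
invariant. Full measure would force `∫ f > 1`, so this set is null, whence `ν₁ ≤ μ` and equality of
masses concludes. -/
theorem extremalProbs_invariantProbs (κ : ι → Kernel Ω Ω) [∀ t, IsMarkovKernel (κ t)] :
    extremalProbs (invariantProbs κ) = ergodicProbs κ := by
  ext μ
  rw [mem_extremalProbs_iff]
  constructor
  · rintro ⟨hμ, hext⟩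
    refine ⟨hμ, fun A hA h => ?_⟩
    by_contra! hcon
    obtain ⟨h0, h1⟩ := hcon
    have h0' : (μ : Measure Ω) Aᶜ ≠ 0 := fun hc => h1 ((prob_compl_eq_zero_iff hA).1 hc)
    obtain ⟨ν₁, hν₁, e₁⟩ := exists_invariant_smul_eq_restrict κ hμ hA h h0
    obtain ⟨ν₂, hν₂, e₂⟩ := exists_invariant_smul_eq_restrict κ hμ hA.compl
      (fun t => indicator_compl_of_indicator (κ t) hA (h t)) h0'
    have hs : μ A + μ Aᶜ = 1 := by
      rw [← ENNReal.coe_inj, ENNReal.coe_add, ProbabilityMeasure.ennreal_coeFn_eq_coeFn_toMeasure,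
        ProbabilityMeasure.ennreal_coeFn_eq_coeFn_toMeasure, prob_add_prob_compl hA,
        ENNReal.coe_one]
    have hpos : ∀ B, (μ : Measure Ω) B ≠ 0 → 0 < μ B := fun B hB => pos_iff_ne_zero.2 fun hc =>
      hB (by rw [← ProbabilityMeasure.ennreal_coeFn_eq_coeFn_toMeasure, hc]; rfl)
    have key := hext ν₁ hν₁ ν₂ hν₂ (μ A) (μ Aᶜ) (hpos _ h0) (hpos _ h0') hs
      (by rw [e₁, e₂, Measure.restrict_add_restrict_compl hA])
    -- With `ν₁ = μ`, evaluation at `Aᶜ` gives `μ A * μ Aᶜ = 0`.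
    have h3 := congrArg (fun m : Measure Ω => m Aᶜ) e₁
    simp only [Measure.smul_apply, Measure.restrict_apply hA.compl, compl_inter_self,
      measure_empty, key] at h3
    rw [ENNReal.smul_def, smul_eq_mul, mul_eq_zero] at h3
    rcases h3 with h3 | h3
    · exact (hpos _ h0).ne' (by simpa using h3)
    · exact h0' h3
  · rintro ⟨hμ, herg⟩
    refine ⟨hμ, fun ν₁ h₁ ν₂ h₂ a b ha hb hab he => Subtype.ext ?_⟩
    change (ν₁ : Measure Ω) = μ
    have hac : (ν₁ : Measure Ω) ≪ μ := by
      intro A hA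
      rw [← he, Measure.add_apply, add_eq_zero, Measure.smul_apply, ENNReal.smul_def, smul_eq_mul,
        mul_eq_zero] at hA
      exact hA.1.resolve_left (by simpa using ha.ne')
    set f := (ν₁ : Measure Ω).rnDeriv μ with hf
    have hfm : Measurable f := Measure.measurable_rnDeriv _ _
    have hνf : (μ : Measure Ω).withDensity f = ν₁ := Measure.withDensity_rnDeriv_eq _ _ hac
    have hint : ∫⁻ x, f x ∂(μ : Measure Ω) = 1 := by
      rw [← setLIntegral_univ, ← withDensity_apply _ MeasurableSet.univ, hνf, measure_univ]
    have hA : MeasurableSet {x | 1 < f x} := measurableSet_lt measurable_const hfm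
    have hz : (μ : Measure Ω) {x | 1 < f x} = 0 := by
      refine (herg {x | 1 < f x} hA fun t =>
        indicator_rnDeriv_gt_one (κ t) (hμ t) (h₁ t) hac).resolve_right fun h1 => ?_
      have h2 : ∀ᵐ x ∂(μ : Measure Ω), 1 < f x := (mem_ae_iff_prob_eq_one hA).2 h1
      have h3 : ∫⁻ _, 1 ∂(μ : Measure Ω) < ∫⁻ x, f x ∂(μ : Measure Ω) :=
        lintegral_strict_mono (IsProbabilityMeasure.ne_zero _) hfm.aemeasurable (by simp) h2
      simp [hint] at h3
    have hle : (ν₁ : Measure Ω) ≤ μ := by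
      rw [← hνf]
      conv_rhs => rw [← withDensity_one (μ := (μ : Measure Ω))]
      refine withDensity_mono ?_
      have : ∀ᵐ x ∂(μ : Measure Ω), ¬ 1 < f x := by
        rw [ae_iff]; simpa using hz
      filter_upwards [this] with x hx using not_lt.1 hx
    exact measure_eq_of_le_of_univ_eq hle (by simp)

/-- A Markov kernel with the Feller property acts continuously on probability measures. -/
theorem continuous_act [TopologicalSpace Ω] [OpensMeasurableSpace Ω] (κ : Kernel Ω Ω)
    [IsMarkovKernel κ]
    (h : ∀ g : BoundedContinuousFunction Ω ℝ, Continuous fun z => ∫ x, g x ∂κ z) :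
    Continuous (act κ) := by
  refine continuous_iff_continuousAt.2 fun μ => ?_
  refine ProbabilityMeasure.tendsto_iff_forall_integral_tendsto.2 fun g => ?_
  have hbound : ∀ z, ‖∫ x, g x ∂κ z‖ ≤ ‖g‖ := fun z => by
    simpa using norm_integral_le_of_norm_le_const (μ := κ z) (.of_forall fun x => g.norm_coe_le_norm x)
  let Kg : BoundedContinuousFunction Ω ℝ := BoundedContinuousFunction.ofNormedAddCommGroup
    (fun z => ∫ x, g x ∂κ z) (h g) ‖g‖ hbound
  -- Duality: `(ν κ) g = ν (κ g)`, with `ν` viewed as a constant kernel on `Unit`.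
  have e : ∀ ν : ProbabilityMeasure Ω, ∫ x, g x ∂(act κ ν : Measure Ω) = ∫ z, Kg z ∂(ν : Measure Ω) := by
    intro ν
    have key := Kernel.integral_comp (η := κ) (κ := Kernel.const Unit (ν : Measure Ω)) (a := ())
      (f := g) (by
        rw [Kernel.comp_apply, Kernel.const_apply]
        exact g.integrable (μ := (act κ ν : Measure Ω)))
    rw [Kernel.comp_apply, Kernel.const_apply] at key
    exact key
  simp only [e]
  exact ProbabilityMeasure.tendsto_iff_forall_integral_tendsto.1 Filter.tendsto_id Kg

end General

/-! ### Lebesgue measure on the half-line: translation and reflection. -/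

/-- Lebesgue measure on `[0, ∞)`. -/
noncomputable def lebesgueNN : Measure ℝ≥0 := (volume.restrict (Ici (0 : ℝ))).map Real.toNNReal

instance : SFinite lebesgueNN := by unfold lebesgueNN; infer_instance

theorem lintegral_lebesgueNN {f : ℝ≥0 → ℝ≥0∞} (hf : Measurable f) :
    ∫⁻ u, f u ∂lebesgueNN = ∫⁻ x : ℝ, (Ici 0).indicator (fun x : ℝ => f x.toNNReal) x := by
  rw [lebesgueNN, lintegral_map hf measurable_real_toNNReal, lintegral_indicator measurableSet_Ici]

theorem lintegral_lebesgueNN_add {f : ℝ≥0 → ℝ≥0∞} (hf : Measurable f) (t : ℝ≥0) :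
    ∫⁻ u, f (t + u) ∂lebesgueNN = ∫⁻ s, (Ici t).indicator f s ∂lebesgueNN := by
  rw [lintegral_lebesgueNN (by fun_prop), lintegral_lebesgueNN (hf.indicator measurableSet_Ici)]
  conv_rhs => rw [← lintegral_add_left_eq_self _ (t : ℝ)]
  have ht := NNReal.coe_nonneg t
  refine lintegral_congr fun x => ?_
  simp only [indicator_apply, mem_Ici]
  by_cases hx : 0 ≤ x
  · have h1 : ((t : ℝ) + x).toNNReal = t + x.toNNReal := by
      rw [Real.toNNReal_add ht hx, Real.toNNReal_coe]
    rw [if_pos hx, if_pos (add_nonneg ht hx), h1, if_pos (self_le_add_right _ _)]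
  · rw [if_neg hx]
    split_ifs with h1 h2
    · exact absurd ((Real.le_toNNReal_iff_coe_le h1).1 h2) (by linarith)
    all_goals rfl

theorem lintegral_lebesgueNN_sub {f : ℝ≥0 → ℝ≥0∞} (hf : Measurable f) (t : ℝ≥0) :
    ∫⁻ s, (Iic t).indicator (fun s => f (t - s)) s ∂lebesgueNN =
      ∫⁻ u, (Iic t).indicator f u ∂lebesgueNN := by
  rw [lintegral_lebesgueNN (Measurable.indicator (by fun_prop) measurableSet_Iic),
    lintegral_lebesgueNN (hf.indicator measurableSet_Iic),
    ← lintegral_sub_left_eq_self _ (t : ℝ)]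
  refine lintegral_congr fun x => ?_
  simp only [indicator_apply, mem_Ici, mem_Iic]
  by_cases hx : 0 ≤ x <;> by_cases hxt : x ≤ t
  · have h2 : x.toNNReal ≤ t := Real.toNNReal_le_iff_le_coe.2 hxt
    have h1 : ((t : ℝ) - x).toNNReal = t - x.toNNReal := NNReal.eq <| by
      rw [NNReal.coe_sub h2, Real.coe_toNNReal _ (sub_nonneg.2 hxt), Real.coe_toNNReal _ hx]
    rw [if_pos (sub_nonneg.2 hxt), h1, if_pos tsub_le_self, if_pos hx, if_pos h2,
      tsub_tsub_cancel_of_le h2]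
  · rw [if_neg (by linarith), if_pos hx, if_neg]
    exact fun h => hxt (Real.toNNReal_le_iff_le_coe.1 h)
  · rw [if_pos (by linarith), if_neg hx, if_neg]
    rw [Real.toNNReal_le_iff_le_coe]
    linarith
  · exact absurd (not_le.1 hx) (by have := t.2; intro h; exact hxt (h.le.trans this))

/-! ### The exponential law and its survival function. -/

namespace System

variable {d : ℕ} {E : Type*} [Fintype E] [DecidableEq E] (S : System d E)

/-- The survival function `u ↦ exp (-lam * u)` of the interarrival times. -/
noncomputable def surv (u : ℝ≥0) : ℝ≥0∞ := ENNReal.ofReal (Real.exp (-(S.lam * u)))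

/-- The parameter `lam` as an extended nonnegative real. -/
noncomputable def intensity : ℝ≥0∞ := ENNReal.ofReal S.lam

@[fun_prop]
theorem measurable_surv : Measurable S.surv := by unfold surv; fun_prop

theorem surv_add (s t : ℝ≥0) : S.surv (s + t) = S.surv s * S.surv t := by
  rw [surv, surv, surv, ← ENNReal.ofReal_mul (Real.exp_pos _).le, ← Real.exp_add, NNReal.coe_add]
  ring_nf

theorem surv_zero : S.surv 0 = 1 := by simp [surv]

theorem surv_ne_zero (t : ℝ≥0) : S.surv t ≠ 0 := by simp [surv, Real.exp_pos]

theorem surv_anti {s t : ℝ≥0} (h : s ≤ t) : S.surv t ≤ S.surv s := by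
  refine ENNReal.ofReal_le_ofReal (Real.exp_le_exp.2 (neg_le_neg ?_))
  exact mul_le_mul_of_nonneg_left (by exact_mod_cast h) S.lam_pos.le

theorem surv_le_one (t : ℝ≥0) : S.surv t ≤ 1 := S.surv_zero ▸ S.surv_anti zero_le

theorem surv_lt_one {t : ℝ≥0} (h : 0 < t) : S.surv t < 1 := by
  rw [surv, ENNReal.ofReal_lt_one, Real.exp_lt_one_iff, neg_lt_zero]
  exact mul_pos S.lam_pos h

theorem expLaw_eq_withDensity :
    S.expLaw = lebesgueNN.withDensity fun u => S.intensity * S.surv u := by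
  ext A hA
  rw [expLaw, Measure.map_apply measurable_real_toNNReal hA, withDensity_apply _ hA,
    ← lintegral_indicator hA,
    lintegral_lebesgueNN (Measurable.indicator (by fun_prop) hA), expMeasure, gammaMeasure,
    withDensity_apply _ (measurable_real_toNNReal hA),
    ← lintegral_indicator (measurable_real_toNNReal hA)]
  refine lintegral_congr fun x => ?_
  change (Real.toNNReal ⁻¹' A).indicator (exponentialPDF S.lam) x = _
  by_cases hxA : x.toNNReal ∈ A
  · rw [indicator_of_mem (show x ∈ Real.toNNReal ⁻¹' A from hxA), exponentialPDF_eq]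
    by_cases hx : 0 ≤ x
    · rw [if_pos hx, indicator_of_mem (show x ∈ Ici 0 from hx), indicator_of_mem hxA, surv,
        intensity, ← ENNReal.ofReal_mul S.lam_pos.le, Real.coe_toNNReal _ hx]
    · simp [hx]
  · rw [indicator_of_notMem (show x ∉ Real.toNNReal ⁻¹' A from hxA)]
    simp [indicator_apply, hxA]

theorem lintegral_expLaw {f : ℝ≥0 → ℝ≥0∞} (hf : Measurable f) :
    ∫⁻ u, f u ∂S.expLaw = ∫⁻ u, S.intensity * S.surv u * f u ∂lebesgueNN := by
  rw [expLaw_eq_withDensity, lintegral_withDensity_eq_lintegral_mul _ (by fun_prop) hf]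
  rfl

theorem expLaw_Ioi (t : ℝ≥0) : S.expLaw (Ioi t) = S.surv t := by
  have := isProbabilityMeasure_expMeasure S.lam_pos
  have h : Real.toNNReal ⁻¹' (Ioi t) = (Iic (t : ℝ))ᶜ := by
    ext x
    simp [Real.lt_toNNReal_iff_coe_lt]
  have hc := cdf_expMeasure_eq S.lam_pos t
  rw [if_pos (NNReal.coe_nonneg t)] at hc
  rw [expLaw, Measure.map_apply measurable_real_toNNReal measurableSet_Ioi, h,
    prob_compl_eq_one_sub measurableSet_Iic, ← ofReal_cdf, hc, ← ENNReal.ofReal_one,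
    ← ENNReal.ofReal_sub _ (by
      rw [sub_nonneg, Real.exp_le_one_iff, neg_nonpos]; exact mul_nonneg S.lam_pos.le t.2),
    sub_sub_cancel, surv]

/-- Here `surv` serves as a Laplace weight: `E e^{-λU} < 1` because `U > 0` almost surely. This is
the geometric ratio that rules out accumulation of jumps. -/
theorem lintegral_surv_lt_one : ∫⁻ u, S.surv u ∂S.expLaw < 1 := by
  have h1 : ∀ᵐ u ∂S.expLaw, S.surv u < 1 := by
    have : ∀ᵐ u ∂S.expLaw, u ∈ Ioi (0 : ℝ≥0) :=
      (mem_ae_iff_prob_eq_one measurableSet_Ioi).2 (by rw [expLaw_Ioi, surv_zero])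
    filter_upwards [this] with u hu using S.surv_lt_one hu
  have h2 : ∫⁻ u, S.surv u ∂S.expLaw ≤ ∫⁻ _, 1 ∂S.expLaw := lintegral_mono S.surv_le_one
  have h3 : ∫⁻ u, S.surv u ∂S.expLaw < ∫⁻ _, 1 ∂S.expLaw :=
    lintegral_strict_mono (IsProbabilityMeasure.ne_zero _) (by fun_prop)
      (h2.trans_lt (by simp)).ne h1
  simpa using h3

end System

/-! ### The path measure, its Markov property, and non-accumulation of jump times. -/

/-- The Markov property of the trajectory measures of the Ionescu-Tulcea theorem. -/
theorem lintegral_traj_succ {X : ℕ → Type*} [∀ n, MeasurableSpace (X n)]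
    (κ : (n : ℕ) → Kernel ((i : Finset.Iic n) → X i) (X (n + 1))) [∀ n, IsMarkovKernel (κ n)]
    (x₀ : (i : Finset.Iic 0) → X i) (n : ℕ)
    {ψ : ((i : Finset.Iic n) → X i) × X (n + 1) → ℝ≥0∞} (hψ : Measurable ψ) :
    ∫⁻ w, ψ (Preorder.frestrictLe n w, w (n + 1)) ∂Kernel.traj κ 0 x₀ =
      ∫⁻ w, ∫⁻ y, ψ (Preorder.frestrictLe n w, y) ∂κ n (Preorder.frestrictLe n w)
        ∂Kernel.traj κ 0 x₀ := by
  have h := Kernel.partialTraj_compProd_eq_map_traj (κ := κ) (Nat.zero_le n) (x₀ := x₀)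
  have hm : Measurable fun w : (n : ℕ) → X n => (Preorder.frestrictLe n w, w (n + 1)) :=
    (Preorder.measurable_frestrictLe n).prodMk (measurable_pi_apply _)
  have hm' : Measurable fun v => ∫⁻ y, ψ (v, y) ∂κ n v := hψ.lintegral_kernel_prod_right'
  rw [← lintegral_map hψ hm, ← h, Measure.lintegral_compProd hψ,
    ← Kernel.traj_map_frestrictLe_apply, lintegral_map hm' (Preorder.measurable_frestrictLe n)]

namespace System

variable {d : ℕ} {E : Type*} [Fintype E] [DecidableEq E] [MeasurableSpace E]
  [DiscreteMeasurableSpace E] (S : System d E)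

theorem _root_.Measurable.move {α : Type*} [MeasurableSpace α] {S : System d E}
    {f : α → S.State} {t : α → ℝ≥0} (hf : Measurable f) (ht : Measurable t) :
    Measurable fun a => S.move (f a) (t a) :=
  S.measurable_move.comp (hf.prodMk ht)

theorem lintegral_moveExp {f : S.State × ℝ≥0 → ℝ≥0∞} (hf : Measurable f) (z : S.State) :
    ∫⁻ y, f y ∂S.moveExp z = ∫⁻ u, f (S.move z u, u) ∂S.expLaw := by
  have hm : Measurable fun p : S.State × ℝ≥0 => (S.move p.1 p.2, p.2) :=
    S.measurable_move.prodMk measurable_snd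
  rw [moveExp, Kernel.lintegral_map _ hm _ hf, Kernel.prod_apply, Kernel.id_apply,
    Kernel.const_apply, lintegral_prod (fun p : S.State × ℝ≥0 => f (S.move p.1 p.2, p.2)) (hf.comp hm).aemeasurable,
    lintegral_dirac']
  exact Measurable.lintegral_prod_right' (hf.comp hm)

theorem lintegral_step {f : S.State × ℝ≥0 → ℝ≥0∞} (hf : Measurable f) (z : S.State) :
    ∫⁻ y, f y ∂S.step z = ∫⁻ u, ∫⁻ z', f (z', u) ∂S.Q (S.move z u) ∂S.expLaw := by
  rw [step, Kernel.lintegral_comp _ _ _ hf, lintegral_moveExp _ hf.lintegral_kernel]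
  refine lintegral_congr fun u => ?_
  rw [Kernel.parallelComp_apply, lintegral_prod _ hf.aemeasurable]
  refine lintegral_congr fun z' => ?_
  rw [Kernel.id_apply, lintegral_dirac' _ (by fun_prop)]

theorem lintegral_Ktilde {g : S.State → ℝ≥0∞} (hg : Measurable g) (z : S.State) :
    ∫⁻ y, g y ∂S.Ktilde z = ∫⁻ u, g (S.move z u) ∂S.expLaw := by
  rw [Ktilde, Kernel.lintegral_map _ measurable_fst _ hg, lintegral_moveExp _ (by fun_prop)]

theorem Ptilde_eq_comp : S.Ptilde = S.Q ∘ₖ S.Ktilde := by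
  refine Kernel.ext_fun fun z g hg => ?_
  rw [Ptilde, Kernel.lintegral_map _ measurable_fst _ hg, lintegral_step _ (by fun_prop),
    Kernel.lintegral_comp _ _ _ hg, lintegral_Ktilde _ hg.lintegral_kernel]

/-- The law of the path when the initial state has law `ν`. -/
noncomputable def pathMeasure (ν : Measure S.State) : Measure S.Path := ν.bind S.pathLaw

instance (ν : Measure S.State) [IsProbabilityMeasure ν] :
    IsProbabilityMeasure (S.pathMeasure ν) := by unfold pathMeasure; infer_instance

theorem lintegral_pathMeasure (ν : Measure S.State) {f : S.Path → ℝ≥0∞} (hf : Measurable f) :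
    ∫⁻ w, f w ∂S.pathMeasure ν = ∫⁻ z, ∫⁻ w, f w ∂S.pathLaw z ∂ν :=
  Measure.lintegral_bind S.pathLaw.aemeasurable hf.aemeasurable

theorem lintegral_bind_P (ν : Measure S.State) (t : ℝ≥0) {g : S.State → ℝ≥0∞}
    (hg : Measurable g) :
    ∫⁻ z, g z ∂(ν.bind (S.P t)) = ∫⁻ w, g (S.Z t w) ∂S.pathMeasure ν := by
  rw [Measure.lintegral_bind (S.P t).aemeasurable hg.aemeasurable,
    lintegral_pathMeasure (f := fun w => g (S.Z t w)) _ _ (hg.comp (S.measurable_Z t))]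
  refine lintegral_congr fun z => ?_
  rw [P, Kernel.lintegral_map _ (S.measurable_Z t) _ hg]

theorem lintegral_pathMeasure_zero (ν : Measure S.State) {f : S.State → ℝ≥0∞}
    (hf : Measurable f) : ∫⁻ w, f (w 0).1 ∂S.pathMeasure ν = ∫⁻ z, f z ∂ν := by
  rw [lintegral_pathMeasure _ _ (by fun_prop)]
  refine lintegral_congr fun z => ?_
  have h := Kernel.traj_map_frestrictLe_apply (X := fun _ : ℕ => S.State × ℝ≥0)
    (κ := S.stepKernel) 0 0 (fun _ => (z, 0))
  have hm : Measurable fun v : (i : Finset.Iic 0) → (fun _ : ℕ => S.State × ℝ≥0) i =>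
    f (v ⟨0, Finset.mem_Iic.2 le_rfl⟩).1 := by fun_prop
  rw [pathLaw, Kernel.comap_apply]
  have h2 := lintegral_map
    (μ := Kernel.traj (X := fun _ : ℕ => S.State × ℝ≥0) S.stepKernel 0 (fun _ => (z, 0))) hm
    (Preorder.measurable_frestrictLe (X := fun _ : ℕ => S.State × ℝ≥0) 0)
  rw [h, Kernel.partialTraj_self, Kernel.id_apply, lintegral_dirac' _ hm] at h2
  exact h2.symm

/-- The Markov property in the only form needed later: `T_n` is a function of the path up to index
`n`, so, given the past, the next pair has law `step`. -/
theorem lintegral_pathMeasure_succ (ν : Measure S.State) (n : ℕ)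
    {φ : (S.State × ℝ≥0) × (S.State × ℝ≥0) → ℝ≥0∞} (hφ : Measurable φ) :
    ∫⁻ w, φ (((w n).1, S.jumpTime n w), w (n + 1)) ∂S.pathMeasure ν =
      ∫⁻ w, ∫⁻ y, φ (((w n).1, S.jumpTime n w), y) ∂S.step (w n).1 ∂S.pathMeasure ν := by
  have hT := S.measurable_jumpTime n
  have hk : Measurable fun p : S.State × ℝ≥0 => ∫⁻ y, φ (p, y) ∂S.step p.1 :=
    Measurable.lintegral_kernel_prod_right' (κ := S.step.comap Prod.fst measurable_fst) hφ
  have hk' : Measurable fun w : S.Path =>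
      ∫⁻ y, φ (((w n).1, S.jumpTime n w), y) ∂S.step (w n).1 :=
    hk.comp (by fun_prop : Measurable fun w : S.Path => ((w n).1, S.jumpTime n w))
  rw [lintegral_pathMeasure _ _ (by fun_prop), lintegral_pathMeasure _ _ hk']
  refine lintegral_congr fun z => ?_
  let T : ((i : Finset.Iic n) → (fun _ : ℕ => S.State × ℝ≥0) i) → ℝ≥0 := fun v =>
    ∑ k : Finset.range n, (v ⟨k + 1, Finset.mem_Iic.2 (Finset.mem_range.1 k.2)⟩).2
  have hTm : Measurable T := by fun_prop
  have hTe : ∀ w : S.Path, T (Preorder.frestrictLe n w) = S.jumpTime n w := fun w =>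
    Finset.sum_coe_sort (Finset.range n) fun k => (w (k + 1)).2
  have h := lintegral_traj_succ (X := fun _ : ℕ => S.State × ℝ≥0) S.stepKernel (fun _ => (z, 0)) n
    (ψ := fun p : ((i : Finset.Iic n) → (fun _ : ℕ => S.State × ℝ≥0) i) × (S.State × ℝ≥0) =>
      φ (((p.1 ⟨n, Finset.mem_Iic.2 le_rfl⟩).1, T p.1), p.2)) (by fun_prop)
  simp only [hTe] at h
  exact h

theorem jumpTime_succ (n : ℕ) (w : S.Path) :
    S.jumpTime (n + 1) w = S.jumpTime n w + (w (n + 1)).2 := Finset.sum_range_succ _ _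

theorem jumpTime_mono (w : S.Path) : Monotone fun n => S.jumpTime n w :=
  monotone_nat_of_le_succ fun n => by rw [jumpTime_succ]; exact le_self_add

/-- `surv` turns sums into products, and the time component of `step` has law `expLaw` from every
state, so each interarrival time contributes one factor. -/
theorem lintegral_surv_jumpTime (ν : Measure S.State) [IsProbabilityMeasure ν] (n : ℕ) :
    ∫⁻ w, S.surv (S.jumpTime n w) ∂S.pathMeasure ν = (∫⁻ u, S.surv u ∂S.expLaw) ^ n := by
  induction n with
  | zero => simp [jumpTime, surv_zero]
  | succ n ih =>
    have hT := S.measurable_jumpTime n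
    have h := S.lintegral_pathMeasure_succ ν n
      (φ := fun p => S.surv p.1.2 * S.surv p.2.2) (by fun_prop)
    simp only [jumpTime_succ, surv_add]
    rw [h, pow_succ, ← ih, ← lintegral_mul_const _ (by fun_prop)]
    refine lintegral_congr fun w => ?_
    dsimp only
    rw [lintegral_const_mul _ (by fun_prop), lintegral_step _ (by fun_prop)]
    simp

/-- Almost surely, the jump times do not accumulate. -/
theorem ae_exists_lt_jumpTime (ν : Measure S.State) [IsProbabilityMeasure ν] (t : ℝ≥0) :
    ∀ᵐ w ∂S.pathMeasure ν, ∃ n, t < S.jumpTime (n + 1) w := by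
  rw [ae_iff]
  set B := {w : S.Path | ¬ ∃ n, t < S.jumpTime (n + 1) w} with hB
  -- Markov's inequality: on `B` every `T_{n+1} ≤ t`, so `surv T_{n+1} ≥ surv t`.
  have hb : ∀ n : ℕ, S.surv t * S.pathMeasure ν B ≤ (∫⁻ u, S.surv u ∂S.expLaw) ^ (n + 1) := by
    intro n
    have hT := S.measurable_jumpTime (n + 1)
    rw [← S.lintegral_surv_jumpTime ν]
    refine le_trans ?_ (mul_meas_ge_le_lintegral (by fun_prop) (S.surv t))
    gcongr
    intro w hw
    refine S.surv_anti (not_lt.1 fun h => hw ⟨n, h⟩)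
  have hlim := (ENNReal.tendsto_pow_atTop_nhds_zero_of_lt_one S.lintegral_surv_lt_one).comp
    (Filter.tendsto_add_atTop_nat 1)
  have h0 := ge_of_tendsto' hlim hb
  exact (mul_eq_zero.1 (nonpos_iff_eq_zero.1 h0)).resolve_left (S.surv_ne_zero t)

/-! ### Expansion of the semigroup by the number of jumps, and the last-jump recursion. -/

/-- The weighted value at `z` moved up to time `t` when `z` is reached at time `s`. -/
noncomputable def afterJump (t : ℝ≥0) (g : S.State → ℝ≥0∞) (z : S.State) (s : ℝ≥0) : ℝ≥0∞ :=
  (Iic t).indicator (fun s => S.surv (t - s) * g (S.move z (t - s))) s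

theorem measurable_afterJump (t : ℝ≥0) {g : S.State → ℝ≥0∞} (hg : Measurable g) :
    Measurable fun p : S.State × ℝ≥0 => S.afterJump t g p.1 p.2 := by
  have h : Measurable fun p : S.State × ℝ≥0 => S.surv (t - p.2) * g (S.move p.1 (t - p.2)) := by
    have h1 : Measurable fun p : S.State × ℝ≥0 => S.move p.1 (t - p.2) :=
      measurable_fst.move (by fun_prop)
    have := hg.comp h1
    exact Measurable.mul (by fun_prop) this
  exact h.indicator (measurable_snd measurableSet_Iic)

/-- The expectation of `g (Z_t)` on the event that exactly `n` jumps occur before time `t`, when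
the initial law is `ν`. -/
noncomputable def jumpTerm (ν : Measure S.State) (n : ℕ) (t : ℝ≥0) (g : S.State → ℝ≥0∞) : ℝ≥0∞ :=
  ∫⁻ w, S.afterJump t g (w n).1 (S.jumpTime n w) ∂S.pathMeasure ν

/-- Integrating out `U_{n+1}` given the past replaces the condition `U_{n+1} > t - T_n` by its
probability `surv (t - T_n)`. -/
theorem lintegral_Z_of_count (ν : Measure S.State) (n : ℕ) (t : ℝ≥0) {g : S.State → ℝ≥0∞}
    (hg : Measurable g) :
    ∫⁻ w, {w : S.Path | S.jumpTime n w ≤ t ∧ t < S.jumpTime (n + 1) w}.indicator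
      (fun w => g (S.move (w n).1 (t - S.jumpTime n w))) w ∂S.pathMeasure ν =
      S.jumpTerm ν n t g := by
  let φ : (S.State × ℝ≥0) × (S.State × ℝ≥0) → ℝ≥0∞ :=
    {p | p.1.2 ≤ t ∧ t - p.1.2 < p.2.2}.indicator fun p => g (S.move p.1.1 (t - p.1.2))
  have hφ : Measurable φ := by
    refine Measurable.indicator (hg.comp (Measurable.move (by fun_prop) (by fun_prop))) ?_
    exact (measurableSet_le (by fun_prop) (by fun_prop)).inter
      (measurableSet_lt (by fun_prop) (by fun_prop))
  have h := S.lintegral_pathMeasure_succ ν n hφ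
  rw [jumpTerm]
  convert h using 1
  · refine lintegral_congr fun w => ?_
    simp only [φ, indicator_apply, mem_ofPred_eq, jumpTime_succ]
    refine if_congr (and_congr_right fun hle => ?_) rfl rfl
    rw [tsub_lt_iff_left hle]
  · refine lintegral_congr fun w => ?_
    rw [lintegral_step _ (by fun_prop)]
    simp only [lintegral_const, measure_univ, mul_one, φ, afterJump, indicator_apply,
      mem_ofPred_eq, mem_Iic]
    by_cases hle : S.jumpTime n w ≤ t
    · have : ∀ u : ℝ≥0, (if S.jumpTime n w ≤ t ∧ t - S.jumpTime n w < u then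
          g (S.move (w n).1 (t - S.jumpTime n w)) else 0) =
          (Ioi (t - S.jumpTime n w)).indicator
            (fun _ => g (S.move (w n).1 (t - S.jumpTime n w))) u := by
        intro u
        simp [indicator_apply, hle]
      simp only [this]
      rw [lintegral_indicator_const measurableSet_Ioi, expLaw_Ioi, if_pos hle, mul_comm]
    · simp [hle]

theorem count_eq {t : ℝ≥0} {w : S.Path} {n : ℕ} (h1 : S.jumpTime n w ≤ t)
    (h2 : t < S.jumpTime (n + 1) w) : S.count t w = n := by
  refine le_antisymm (Nat.sInf_le h2) (le_csInf ⟨n, h2⟩ fun k hk => ?_)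
  by_contra! hlt
  exact absurd ((S.jumpTime_mono w hlt).trans h1) (not_le.2 hk)

theorem count_spec {t : ℝ≥0} {w : S.Path} (h : ∃ n, t < S.jumpTime (n + 1) w) :
    S.jumpTime (S.count t w) w ≤ t ∧ t < S.jumpTime (S.count t w + 1) w := by
  refine ⟨?_, Nat.sInf_mem (s := {n | t < S.jumpTime (n + 1) w}) h⟩
  rcases hc : S.count t w with _ | k
  · simp [jumpTime]
  · exact not_lt.1 (Nat.notMem_of_lt_sInf (s := {n | t < S.jumpTime (n + 1) w})
      (show k < S.count t w by omega))

/-- The law of `Z_t` is obtained by summing over the number of jumps before time `t`. -/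
theorem lintegral_bind_P_eq_tsum (ν : Measure S.State) [IsProbabilityMeasure ν] (t : ℝ≥0)
    {g : S.State → ℝ≥0∞} (hg : Measurable g) :
    ∫⁻ z, g z ∂(ν.bind (S.P t)) = ∑' n, S.jumpTerm ν n t g := by
  simp only [← S.lintegral_Z_of_count ν _ t hg]
  rw [← lintegral_tsum, lintegral_bind_P _ _ _ hg]
  · refine lintegral_congr_ae ?_
    -- Where no jump time exceeds `t`, `count` takes the default value `0`; these paths form a null
    -- set.
    filter_upwards [S.ae_exists_lt_jumpTime ν t] with w hw
    have hc := S.count_spec hw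
    rw [tsum_eq_single (S.count t w), indicator_of_mem (by exact hc), Z]
    intro n hn
    exact indicator_of_notMem (fun h => hn (S.count_eq h.1 h.2).symm) _
  · intro n
    have h1 := S.measurable_jumpTime n
    have h2 := S.measurable_jumpTime (n + 1)
    refine (Measurable.indicator (hg.comp (Measurable.move (by fun_prop) (by fun_prop))) ?_).aemeasurable
    have h3 : MeasurableSet {w | t < S.jumpTime (n + 1) w} := measurableSet_lt measurable_const h2
    exact (measurableSet_le h1 measurable_const).inter h3

theorem jumpTerm_zero (ν : Measure S.State) (t : ℝ≥0) {g : S.State → ℝ≥0∞} (hg : Measurable g) :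
    S.jumpTerm ν 0 t g = S.surv t * ∫⁻ z, g (S.move z t) ∂ν := by
  have hm : Measurable fun z : S.State => g (S.move z t) :=
    hg.comp (measurable_id.move measurable_const)
  rw [← lintegral_const_mul _ hm, ← lintegral_pathMeasure_zero _ _ (hm.const_mul _), jumpTerm]
  simp [afterJump, jumpTime]

/-- The function `z ↦ Q (K_t g) z`. -/
noncomputable def QK (t : ℝ≥0) (g : S.State → ℝ≥0∞) (z : S.State) : ℝ≥0∞ :=
  ∫⁻ y, g (S.move y t) ∂S.Q z

theorem measurable_QK {g : S.State → ℝ≥0∞} (hg : Measurable g) :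
    Measurable fun p : S.State × ℝ≥0 => S.QK p.2 g p.1 := by
  have : Measurable fun q : (S.State × ℝ≥0) × S.State => g (S.move q.2 q.1.2) :=
    hg.comp (Measurable.move (by fun_prop) (by fun_prop))
  exact Measurable.lintegral_kernel_prod_right' (κ := S.Q.comap Prod.fst measurable_fst) this

theorem measurable_QK_left (t : ℝ≥0) {g : S.State → ℝ≥0∞} (hg : Measurable g) :
    Measurable (S.QK t g) :=
  Measurable.comp (g := fun p : S.State × ℝ≥0 => S.QK p.2 g p.1) (f := fun z => (z, t))
    (S.measurable_QK hg) measurable_prodMk_right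

theorem lintegral_afterJump_Q (t : ℝ≥0) {g : S.State → ℝ≥0∞} (hg : Measurable g) (z : S.State)
    (s : ℝ≥0) : ∫⁻ z', S.afterJump t g z' s ∂S.Q z =
      (Iic t).indicator (fun s => S.surv (t - s) * S.QK (t - s) g z) s := by
  by_cases hs : s ∈ Iic t
  · have hm : Measurable fun z' : S.State => g (S.move z' (t - s)) :=
      hg.comp (measurable_id.move measurable_const)
    simp only [afterJump, indicator_of_mem hs]
    rw [lintegral_const_mul _ hm, QK]
  · simp [afterJump, indicator_of_notMem hs]

/-- The density, at the time `s`, of the contribution of a jump at time `s` from `z`, reached at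
time `T`, to the expectation of `g` at time `t`. -/
noncomputable def jumpDensity (t : ℝ≥0) (g : S.State → ℝ≥0∞) (z : S.State) (T s : ℝ≥0) : ℝ≥0∞ :=
  (Iic t).indicator (fun s => S.intensity * S.surv (t - s) *
    S.afterJump s (S.QK (t - s) g) z T) s

/-- Two ways to encode `T ≤ s ≤ t`. With `s ≤ t` outermost, integration over paths produces
`jumpTerm`; with `T ≤ s` outermost, the substitution `s = T + u` applies. -/
theorem jumpDensity_eq (t : ℝ≥0) (g : S.State → ℝ≥0∞) (z : S.State) (T s : ℝ≥0) :
    S.jumpDensity t g z T s = (Ici T).indicator (fun s => S.intensity * S.surv (s - T) *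
      (Iic t).indicator (fun s' => S.surv (t - s') * S.QK (t - s') g (S.move z (s - T))) s) s := by
  by_cases hs : s ∈ Iic t
  · by_cases hT : T ≤ s
    · rw [jumpDensity, indicator_of_mem hs, indicator_of_mem (show s ∈ Ici T from hT),
        indicator_of_mem hs, afterJump, indicator_of_mem (show T ∈ Iic s from hT)]
      ring
    · rw [jumpDensity, indicator_of_mem hs, indicator_of_notMem (show s ∉ Ici T from hT),
        afterJump, indicator_of_notMem (show T ∉ Iic s from hT), mul_zero]
  · rw [jumpDensity, indicator_of_notMem hs]
    by_cases hT : s ∈ Ici T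
    · rw [indicator_of_mem hT, indicator_of_notMem hs, mul_zero]
    · rw [indicator_of_notMem hT]

theorem measurable_indicator_QK (t : ℝ≥0) {g : S.State → ℝ≥0∞} (hg : Measurable g) :
    Measurable fun p : S.State × ℝ≥0 =>
      (Iic t).indicator (fun s => S.surv (t - s) * S.QK (t - s) g p.1) p.2 := by
  refine Measurable.indicator (f := fun p : S.State × ℝ≥0 =>
    S.surv (t - p.2) * S.QK (t - p.2) g p.1) ?_ (measurable_snd measurableSet_Iic)
  have := (S.measurable_QK hg).comp
    (by fun_prop : Measurable fun p : S.State × ℝ≥0 => (p.1, t - p.2))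
  exact Measurable.mul (by fun_prop) this

theorem measurable_jumpDensity_aux (t : ℝ≥0) {g : S.State → ℝ≥0∞} (hg : Measurable g) :
    Measurable fun p : (S.State × ℝ≥0) × ℝ≥0 => S.intensity * S.surv (p.2 - p.1.2) *
      (Iic t).indicator (fun s' => S.surv (t - s') *
        S.QK (t - s') g (S.move p.1.1 (p.2 - p.1.2))) p.2 := by
  refine Measurable.mul (by fun_prop) ((S.measurable_indicator_QK t hg).comp
    (Measurable.prodMk (Measurable.move ?_ ?_) measurable_snd)) <;> fun_prop

theorem measurable_jumpDensity (t : ℝ≥0) {g : S.State → ℝ≥0∞} (hg : Measurable g) :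
    Measurable fun p : (S.State × ℝ≥0) × ℝ≥0 => S.jumpDensity t g p.1.1 p.1.2 p.2 := by
  simp only [jumpDensity_eq]
  refine Measurable.indicator (S.measurable_jumpDensity_aux t hg)
    (s := {p : (S.State × ℝ≥0) × ℝ≥0 | p.1.2 ≤ p.2}) ?_
  exact measurableSet_le (by fun_prop) (by fun_prop)

/-- The next jump time `s = T + u` has density `λ e^{-λ(s-T)}` on `[T, ∞)`; the redraw by `Q`
followed by the flow for time `t - s` gives `QK (t - s) g`. -/
theorem lintegral_afterJump_step (t : ℝ≥0) {g : S.State → ℝ≥0∞} (hg : Measurable g) (z : S.State)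
    (T : ℝ≥0) : ∫⁻ y, S.afterJump t g y.1 (T + y.2) ∂S.step z =
      ∫⁻ s, S.jumpDensity t g z T s ∂lebesgueNN := by
  have hf := (S.measurable_jumpDensity_aux t hg).comp
    (measurable_prodMk_left (x := (z, T)) : Measurable fun s : ℝ≥0 => ((z, T), s))
  simp only [jumpDensity_eq]
  refine Eq.trans ?_ (lintegral_lebesgueNN_add hf T)
  rw [lintegral_step (f := fun y => S.afterJump t g y.1 (T + y.2)) _
    ((S.measurable_afterJump t hg).comp (by fun_prop :
    Measurable fun y : S.State × ℝ≥0 => (y.1, T + y.2))),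
    lintegral_expLaw]
  · refine lintegral_congr fun u => ?_
    simp only [Function.comp_apply]
    rw [lintegral_afterJump_Q _ _ hg, add_tsub_cancel_left]
  · simp only [S.lintegral_afterJump_Q t hg]
    exact (S.measurable_indicator_QK t hg).comp (Measurable.prodMk
      (Measurable.move measurable_const measurable_id) (by fun_prop))

theorem measurable_prodMk_jumpTime (n : ℕ) :
    Measurable fun w : S.Path => ((w n).1, S.jumpTime n w) :=
  (by fun_prop : Measurable fun w : S.Path => (w n).1).prodMk (S.measurable_jumpTime n)

theorem lintegral_jumpDensity (ν : Measure S.State) (n : ℕ) (t s : ℝ≥0)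
    {g : S.State → ℝ≥0∞} (hg : Measurable g) :
    ∫⁻ w, S.jumpDensity t g (w n).1 (S.jumpTime n w) s ∂S.pathMeasure ν =
      (Iic t).indicator (fun s => S.intensity * S.surv (t - s) *
        S.jumpTerm ν n s (S.QK (t - s) g)) s := by
  by_cases hs : s ∈ Iic t
  · have hm := (S.measurable_afterJump s (S.measurable_QK_left (t - s) hg)).comp
      (S.measurable_prodMk_jumpTime n)
    simp only [jumpDensity, indicator_of_mem hs]
    exact lintegral_const_mul _ hm
  · simp [jumpDensity, indicator_of_notMem hs]

theorem measurable_indicator_jumpTerm (ν : Measure S.State) [IsProbabilityMeasure ν] (n : ℕ)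
    (t : ℝ≥0) {g : S.State → ℝ≥0∞} (hg : Measurable g) :
    Measurable fun s => (Iic t).indicator (fun s => S.intensity * S.surv (t - s) *
        S.jumpTerm ν n s (S.QK (t - s) g)) s := by
  simp only [← S.lintegral_jumpDensity ν n t _ hg]
  exact Measurable.lintegral_prod_left' ((S.measurable_jumpDensity t hg).comp
    (((S.measurable_prodMk_jumpTime n).comp measurable_fst).prodMk measurable_snd))

/-- Decomposition at the last jump before time `t`. -/
theorem jumpTerm_succ (ν : Measure S.State) [IsProbabilityMeasure ν] (n : ℕ) (t : ℝ≥0)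
    {g : S.State → ℝ≥0∞} (hg : Measurable g) :
    S.jumpTerm ν (n + 1) t g = ∫⁻ s, (Iic t).indicator (fun s => S.intensity * S.surv (t - s) *
      S.jumpTerm ν n s (S.QK (t - s) g)) s ∂lebesgueNN := by
  have h := S.lintegral_pathMeasure_succ ν n
    (φ := fun p => S.afterJump t g p.2.1 (p.1.2 + p.2.2))
    ((S.measurable_afterJump t hg).comp (by fun_prop :
      Measurable fun p : (S.State × ℝ≥0) × (S.State × ℝ≥0) => (p.2.1, p.1.2 + p.2.2)))
  simp only [← jumpTime_succ] at h
  rw [jumpTerm, h]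
  simp only [S.lintegral_afterJump_step t hg]
  -- Tonelli: with the last jump time `s` frozen, the path integral is the `n`-jump term at time `s`
  -- of the function `QK (t - s) g`.
  rw [lintegral_lintegral_swap]
  · exact lintegral_congr fun s => S.lintegral_jumpDensity ν n t s hg
  · exact ((S.measurable_jumpDensity t hg).comp
      (((S.measurable_prodMk_jumpTime n).comp measurable_fst).prodMk measurable_snd)).aemeasurable

end System

/-! ### Invariance for the semigroup as a fixed-point equation. -/

instance : NullSingletonClass lebesgueNN where
  measure_singleton t := by
    rw [lebesgueNN, Measure.map_apply measurable_real_toNNReal (measurableSet_singleton t),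
      Measure.restrict_apply (measurable_real_toNNReal (measurableSet_singleton t))]
    -- For `t = 0` the preimage under `Real.toNNReal` is a whole half-line; the restriction to `Ici
    -- 0` cuts it down to one point.
    refine measure_mono_null (t := {(t : ℝ)}) ?_ Real.volume_singleton
    rintro x ⟨hx, hx0⟩
    have hx' : x.toNNReal = t := hx
    rw [mem_singleton_iff, ← hx', Real.coe_toNNReal _ hx0]

/-- Both sides, as functions of `t`, solve the same equation from the same point. The field is only
known to be Lipschitz on bounded sets, so uniqueness by Grönwall uses that both trajectories stay in
the compact set `M`. -/
theorem flow_flow {d : ℕ} {F : EuclideanSpace ℝ (Fin d) → EuclideanSpace ℝ (Fin d)}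
    (hF : ContDiff ℝ ∞ F) {C : ℝ} (hC : ∀ x, ‖F x‖ ≤ C) {M : Set (EuclideanSpace ℝ (Fin d))}
    (hM : IsCompact M) (hinv : ∀ t, 0 ≤ t → ∀ x ∈ M, flow F t x ∈ M)
    {x : EuclideanSpace ℝ (Fin d)} (hx : x ∈ M) {u t : ℝ} (hu : 0 ≤ u) (ht : 0 ≤ t) :
    flow F t (flow F u x) = flow F (u + t) x := by
  obtain ⟨R, hR⟩ := hM.isBounded.subset_closedBall 0
  obtain ⟨K, hK⟩ := exists_lipschitzOnWith_closedBall hF 0 R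
  have hd := fun x => (flow_spec hF hC x).2
  have h0 := fun x => (flow_spec hF hC x).1
  have hc : ∀ x, Continuous fun t => flow F t x := fun x =>
    continuous_iff_continuousAt.2 fun s => (hd x s).continuousAt
  have hd' : ∀ s, HasDerivAt (fun s => flow F (u + s) x) (F (flow F (u + s) x)) s := fun s =>
    (hd x (u + s)).comp_const_add u s
  have h := dist_le_of_trajectories_ODE_of_mem (v := fun _ => F) (s := fun _ => M) (K := K)
    (f := fun s => flow F s (flow F u x)) (g := fun s => flow F (u + s) x) (a := 0) (b := t)
    (δ := 0) (fun _ _ => hK.mono hR) (hc _).continuousOn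
    (fun s _ => (hd _ s).hasDerivWithinAt) (fun s hs => hinv s hs.1 _ (hinv u hu x hx))
    ((hc x).comp (by fun_prop)).continuousOn
    (fun s _ => (hd' s).hasDerivWithinAt) (fun s hs => hinv _ (add_nonneg hu hs.1) x hx)
    (by simp [h0]) t ⟨ht, le_rfl⟩
  rw [zero_mul] at h
  exact dist_le_zero.1 h

namespace System

variable {d : ℕ} {E : Type*} [Fintype E] [DecidableEq E] (S : System d E)

theorem move_move (z : S.State) (u t : ℝ≥0) : S.move (S.move z u) t = S.move z (u + t) := by
  obtain ⟨C, hC⟩ := S.bounded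
  refine Prod.ext (Subtype.ext ?_) rfl
  exact flow_flow (S.smooth z.2) (hC z.2) S.isCompact (S.invariant z.2) z.1.2 u.2 t.2

variable [MeasurableSpace E] [DiscreteMeasurableSpace E]

theorem measurable_lintegral_QK (ν : Measure S.State) [SFinite ν] {g : S.State → ℝ≥0∞}
    (hg : Measurable g) : Measurable fun u => ∫⁻ z, S.QK u g z ∂ν :=
  (S.measurable_QK hg).lintegral_prod_left'

/-- Tonelli brings the exponential time outside. Cut off at `u ≤ t`, the same integrand is, after `u
= t - s`, the one in the last-jump recursion. -/
theorem lintegral_bind_Q_bind_Ktilde (ν : Measure S.State) [SFinite ν] {g : S.State → ℝ≥0∞}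
    (hg : Measurable g) :
    ∫⁻ z, g z ∂((ν.bind S.Q).bind S.Ktilde) =
      ∫⁻ u, S.intensity * S.surv u * ∫⁻ z, S.QK u g z ∂ν ∂lebesgueNN := by
  have hm : Measurable fun p : S.State × ℝ≥0 => g (S.move p.1 p.2) := hg.comp S.measurable_move
  rw [← lintegral_expLaw _ (S.measurable_lintegral_QK ν hg),
    ← lintegral_lintegral_swap (S.measurable_QK hg).aemeasurable,
    Measure.lintegral_bind S.Ktilde.aemeasurable hg.aemeasurable,
    Measure.lintegral_bind S.Q.aemeasurable hg.lintegral_kernel.aemeasurable]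
  refine lintegral_congr fun z => ?_
  simp only [S.lintegral_Ktilde hg, QK]
  exact lintegral_lintegral_swap hm.aemeasurable

theorem QK_comp_move (g : S.State → ℝ≥0∞) (u t : ℝ≥0) (z : S.State) :
    S.QK u (fun y => g (S.move y t)) z = S.QK (t + u) g z := by
  simp only [QK, move_move, add_comm]

/-- A probability `ν` with `ν Q K̃ = ν` solves the last jump equation. -/
theorem lintegral_eq_of_bind_Q_bind_Ktilde {ν : Measure S.State} [SFinite ν]
    (h : (ν.bind S.Q).bind S.Ktilde = ν) (t : ℝ≥0) {g : S.State → ℝ≥0∞} (hg : Measurable g) :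
    ∫⁻ z, g z ∂ν = S.surv t * ∫⁻ z, g (S.move z t) ∂ν +
      ∫⁻ s, (Iic t).indicator (fun s => S.intensity * S.surv (t - s) *
        ∫⁻ z, S.QK (t - s) g z ∂ν) s ∂lebesgueNN := by
  have hgt : Measurable fun z : S.State => g (S.move z t) :=
    hg.comp (measurable_id.move measurable_const)
  have hF : Measurable fun u => S.intensity * S.surv u * ∫⁻ z, S.QK u g z ∂ν :=
    Measurable.mul (by fun_prop) (S.measurable_lintegral_QK ν hg)
  rw [lintegral_lebesgueNN_sub hF t, lintegral_indicator measurableSet_Iic]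
  -- Expand `ν` as `ν Q K̃`, split the time integral at `t`, and shift the tail back to start at
  -- `0`.
  conv_lhs => rw [← h, lintegral_bind_Q_bind_Ktilde _ _ hg,
    ← lintegral_add_compl _ (measurableSet_Iic (a := t)), compl_Iic,
    setLIntegral_congr Ioi_ae_eq_Ici, ← lintegral_indicator measurableSet_Ici,
    ← lintegral_lebesgueNN_add hF t]
  -- The same expansion, applied to `g` moved by `t`, identifies the shifted tail, since `surv (t +
  -- u)` factors.
  conv_rhs =>
    enter [1, 2]
    rw [← h, lintegral_bind_Q_bind_Ktilde _ _ hgt]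
  have hFt : Measurable fun u =>
      S.intensity * S.surv u * ∫⁻ z, S.QK u (fun y => g (S.move y t)) z ∂ν :=
    Measurable.mul (by fun_prop) (S.measurable_lintegral_QK ν hgt)
  rw [add_comm, ← lintegral_const_mul _ hFt]
  congr 1
  refine lintegral_congr fun u => ?_
  simp only [QK_comp_move, surv_add]
  ring

theorem bind_P_of_bind_Q_bind_Ktilde {ν : Measure S.State} [IsProbabilityMeasure ν]
    (h : (ν.bind S.Q).bind S.Ktilde = ν) (t : ℝ≥0) : ν.bind (S.P t) = ν := by
  -- Time and function must stay general in the induction: the recursion calls the bound at an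
  -- earlier time `s` for `QK (t - s) g`.
  have hsum : ∀ n t (g : S.State → ℝ≥0∞), Measurable g →
      ∑ k ∈ Finset.range n, S.jumpTerm ν k t g ≤ ∫⁻ z, g z ∂ν := by
    intro n
    induction n with
    | zero => simp
    | succ n ih =>
      intro t g hg
      rw [Finset.sum_range_succ', S.lintegral_eq_of_bind_Q_bind_Ktilde h t hg,
        S.jumpTerm_zero ν t hg, add_comm]
      refine add_le_add le_rfl ?_
      simp only [S.jumpTerm_succ ν _ t hg]
      rw [← lintegral_finsetSum _ fun k _ => S.measurable_indicator_jumpTerm ν k t hg]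
      refine lintegral_mono fun s => ?_
      by_cases hs : s ∈ Iic t
      · simp only [indicator_of_mem hs]
        rw [← Finset.mul_sum]
        gcongr
        exact ih s _ (S.measurable_QK_left _ hg)
      · simp [indicator_of_notMem hs]
  refine measure_eq_of_le_of_univ_eq (Measure.le_iff.2 fun A hA => ?_) (bind_univ _ ν)
  have hg : Measurable (A.indicator (1 : S.State → ℝ≥0∞)) := measurable_one.indicator hA
  rw [← lintegral_indicator_one hA, ← lintegral_indicator_one hA, lintegral_bind_P_eq_tsum _ _ _ hg]
  exact ENNReal.tsum_le_of_sum_range_le fun n => hsum n t _ hg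

/-- The terms with at least one jump add up to at most `ν g`; by invariance at each earlier time
their sum is the integral defining `ν Q K̃ g`, truncated at `t`. -/
theorem bind_Q_bind_Ktilde_of_bind_P {ν : Measure S.State} [IsProbabilityMeasure ν]
    (h : ∀ t, ν.bind (S.P t) = ν) : (ν.bind S.Q).bind S.Ktilde = ν := by
  refine measure_eq_of_le_of_univ_eq (Measure.le_iff.2 fun A hA => ?_)
    (by rw [bind_univ, bind_univ])
  have hg : Measurable (A.indicator (1 : S.State → ℝ≥0∞)) := measurable_one.indicator hA
  rw [← lintegral_indicator_one hA, ← lintegral_indicator_one hA]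
  generalize A.indicator (1 : S.State → ℝ≥0∞) = g at hg
  have hF : Measurable fun u => S.intensity * S.surv u * ∫⁻ z, S.QK u g z ∂ν :=
    Measurable.mul (by fun_prop) (S.measurable_lintegral_QK ν hg)
  have hle : ∀ t, ∫⁻ u in Iic t, S.intensity * S.surv u * ∫⁻ z, S.QK u g z ∂ν ∂lebesgueNN ≤
      ∫⁻ z, g z ∂ν := by
    intro t
    rw [← lintegral_indicator measurableSet_Iic, ← lintegral_lebesgueNN_sub hF t]
    conv_rhs => rw [← h t, lintegral_bind_P_eq_tsum _ _ _ hg, tsum_eq_zero_add' ENNReal.summable]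
    -- The no-jump term is discarded; it is the only loss.
    refine le_trans (le_of_eq ?_) le_add_self
    simp only [S.jumpTerm_succ ν _ t hg]
    rw [← lintegral_tsum fun k => (S.measurable_indicator_jumpTerm ν k t hg).aemeasurable]
    refine lintegral_congr fun s => ?_
    by_cases hs : s ∈ Iic t
    · simp only [indicator_of_mem hs]
      -- Summing over `n` rebuilds `ν P_s`, which is `ν`.
      rw [ENNReal.tsum_mul_left, ← lintegral_bind_P_eq_tsum, h s]
      exact S.measurable_QK_left _ hg
    · simp [indicator_of_notMem hs]
  have hU : ⋃ n : ℕ, Iic (n : ℝ≥0) = univ :=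
    eq_univ_of_forall fun x => mem_iUnion.2 (exists_nat_ge x)
  rw [lintegral_bind_Q_bind_Ktilde _ _ hg, ← setLIntegral_univ, ← hU,
    setLIntegral_iUnion_of_directed]
  · exact iSup_le fun n => hle n
  · exact Monotone.directed_le fun m n hmn => Iic_subset_Iic.2 (by exact_mod_cast hmn)

theorem mem_invSemigroup_iff (ν : ProbabilityMeasure S.State) :
    ν ∈ S.invSemigroup ↔ act S.Ktilde (act S.Q ν) = ν := by
  refine Iff.trans ?_ Subtype.ext_iff.symm
  exact ⟨fun h => S.bind_Q_bind_Ktilde_of_bind_P h, fun h t => S.bind_P_of_bind_Q_bind_Ktilde h t⟩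

theorem mem_invChain_iff (μ : ProbabilityMeasure S.State) :
    μ ∈ S.invChain ↔ act S.Q (act S.Ktilde μ) = μ := by
  refine Iff.trans ?_ Subtype.ext_iff.symm
  have h : (μ : Measure S.State).bind S.Ptilde = ((μ : Measure S.State).bind S.Ktilde).bind S.Q := by
    rw [Ptilde_eq_comp, Measure.comp_assoc]
  change (∀ _ : Unit, (μ : Measure S.State).bind S.Ptilde = μ) ↔
    ((μ : Measure S.State).bind S.Ktilde).bind S.Q = μ
  rw [h, forall_const]

theorem Ktilde_apply (z : S.State) : S.Ktilde z = S.expLaw.map fun u => S.move z u := by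
  have hm : Measurable fun u => S.move z u := measurable_const.move measurable_id
  refine Measure.ext_of_lintegral _ fun g hg => ?_
  rw [S.lintegral_Ktilde hg, lintegral_map hg hm]

/-! ### Feller continuity of the two kernels. -/

variable [TopologicalSpace E] [DiscreteTopology E]

theorem continuous_move (u : ℝ≥0) : Continuous fun z : S.State => S.move z u := by
  obtain ⟨C, hC⟩ := S.bounded
  refine continuous_prod_of_discrete_right.2 fun i => ?_
  have h := (continuous_flow_restrict (S.smooth i) (hC i) S.isCompact (S.invariant i)).comp
    (continuous_id.prodMk (continuous_const (y := u)))
  exact (h.subtype_mk _).prodMk continuous_const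

/-- For each fixed time the flow is continuous in the state; dominated convergence, with bound
`‖g‖`, averages this over the exponential time. -/
theorem continuous_act_Ktilde : Continuous (act S.Ktilde) := by
  refine continuous_act S.Ktilde fun g => ?_
  have e : ∀ z, ∫ x, g x ∂S.Ktilde z = ∫ u, g (S.move z u) ∂S.expLaw := fun z => by
    have hm : Measurable fun u => S.move z u := measurable_const.move measurable_id
    rw [Ktilde_apply, integral_map hm.aemeasurable]
    exact g.continuous.measurable.aestronglyMeasurable
  simp only [e]
  refine continuous_of_dominated (bound := fun _ => ‖g‖) (fun z => ?_)
    (fun z => .of_forall fun u => g.norm_coe_le_norm _) (integrable_const _)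
    (.of_forall fun u => g.continuous.comp (S.continuous_move u))
  have hm : Measurable fun u => S.move z u := measurable_const.move measurable_id
  exact (g.continuous.measurable.comp hm).aestronglyMeasurable

theorem continuous_act_Q : Continuous (act S.Q) := by
  refine continuous_act S.Q fun g => ?_
  have e : ∀ z, ∫ x, g x ∂S.Q z = ∑ j, S.Qmat z.1 z.2 j * g (z.1, j) := fun z => by
    rw [Q_apply, integral_finsetSum_measure]
    · refine Finset.sum_congr rfl fun j _ => ?_
      rw [integral_smul_measure, integral_dirac' _ _ g.continuous.measurable.stronglyMeasurable,
        ENNReal.toReal_ofReal (S.Qmat_nonneg _ _ _), smul_eq_mul]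
    · intro j _
      exact (g.integrable (μ := Measure.dirac (z.1, j))).smul_measure ENNReal.ofReal_ne_top
  simp only [e]
  refine continuous_finsetSum _ fun j _ => Continuous.mul ?_ (by fun_prop)
  exact continuous_prod_of_discrete_right.2 fun i => S.continuous_Qmat i j

end System

/-! ### Transport of extremal points, and the conclusion. -/

theorem coe_act_of_smul_add {Ω : Type*} [MeasurableSpace Ω] (κ : Kernel Ω Ω) [IsMarkovKernel κ]
    {μ μ₁ μ₂ : ProbabilityMeasure Ω} {a b : ℝ≥0}
    (h : a • (μ₁ : Measure Ω) + b • (μ₂ : Measure Ω) = μ) :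
    a • (act κ μ₁ : Measure Ω) + b • (act κ μ₂ : Measure Ω) = act κ μ := by
  simp only [act, ProbabilityMeasure.coe_mk]
  rw [← h, bind_add_measure, bind_smul_measure, bind_smul_measure]

/-- The action is affine, so a convex decomposition of the image pulls back along `η` to one of `μ`,
which is trivial. -/
theorem act_mem_extremalProbs {Ω : Type*} [MeasurableSpace Ω] (κ η : Kernel Ω Ω)
    [IsMarkovKernel κ] [IsMarkovKernel η] {I J : Set (ProbabilityMeasure Ω)}
    (hκ : MapsTo (act κ) I J) (hη : MapsTo (act η) J I) (hηκ : LeftInvOn (act η) (act κ) I)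
    (hκη : LeftInvOn (act κ) (act η) J) {μ : ProbabilityMeasure Ω} (hμ : μ ∈ extremalProbs I) :
    act κ μ ∈ extremalProbs J := by
  rw [mem_extremalProbs_iff] at hμ ⊢
  refine ⟨hκ hμ.1, fun ν₁ h₁ ν₂ h₂ a b ha hb hab he => ?_⟩
  have h := coe_act_of_smul_add η he
  rw [hηκ hμ.1] at h
  rw [← hμ.2 _ (hη h₁) _ (hη h₂) a b ha hb hab h, hκη h₁]

end SwitchedPDMP

theorem mainTheorem9 {d : ℕ} {E : Type*} [Fintype E] [DecidableEq E]
    [TopologicalSpace E] [DiscreteTopology E] [MeasurableSpace E] [DiscreteMeasurableSpace E]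
    (S : SwitchedPDMP.System d E) :
    (∃ h : S.invChain ≃ₜ S.invSemigroup,
      (∀ μ : S.invChain, (h μ : ProbabilityMeasure S.State) = SwitchedPDMP.act S.Ktilde μ) ∧
      (∀ ν : S.invSemigroup, (h.symm ν : ProbabilityMeasure S.State) = SwitchedPDMP.act S.Q ν)) ∧
    SwitchedPDMP.act S.Ktilde '' SwitchedPDMP.extremalProbs S.invChain =
      SwitchedPDMP.extremalProbs S.invSemigroup ∧
    SwitchedPDMP.extremalProbs S.invChain = SwitchedPDMP.ergodicProbs (fun _ : Unit => S.Ptilde) ∧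
    SwitchedPDMP.extremalProbs S.invSemigroup = SwitchedPDMP.ergodicProbs S.P ∧
    (SwitchedPDMP.Stable S.invSemigroup ↔ SwitchedPDMP.Stable S.invChain) := by
  have hQK : LeftInvOn (SwitchedPDMP.act S.Q) (SwitchedPDMP.act S.Ktilde) S.invChain :=
    fun μ hμ => (S.mem_invChain_iff μ).1 hμ
  have hKQ : LeftInvOn (SwitchedPDMP.act S.Ktilde) (SwitchedPDMP.act S.Q) S.invSemigroup :=
    fun ν hν => (S.mem_invSemigroup_iff ν).1 hν
  -- Apply `K̃` to `μ K̃ Q = μ`: the measure `μ K̃` is then fixed by `Q` followed by `K̃`.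
  have hK : MapsTo (SwitchedPDMP.act S.Ktilde) S.invChain S.invSemigroup := fun μ hμ =>
    (S.mem_invSemigroup_iff _).2 (congrArg _ (hQK hμ))
  have hQ : MapsTo (SwitchedPDMP.act S.Q) S.invSemigroup S.invChain := fun ν hν =>
    (S.mem_invChain_iff _).2 (congrArg _ (hKQ hν))
  refine ⟨⟨{ toFun := hK.restrict _ _ _
             invFun := hQ.restrict _ _ _
             left_inv := fun μ => Subtype.ext (hQK μ.2)
             right_inv := fun ν => Subtype.ext (hKQ ν.2)
             continuous_toFun := S.continuous_act_Ktilde.continuousOn.mapsToRestrict hK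
             continuous_invFun := S.continuous_act_Q.continuousOn.mapsToRestrict hQ },
      fun _ => rfl, fun _ => rfl⟩, ?_, SwitchedPDMP.extremalProbs_invariantProbs _,
    SwitchedPDMP.extremalProbs_invariantProbs _, ?_⟩
  · refine Subset.antisymm ?_ fun ν hν => ?_
    · rintro _ ⟨μ, hμ, rfl⟩
      exact SwitchedPDMP.act_mem_extremalProbs _ _ hK hQ hQK hKQ hμ
    · exact ⟨_, SwitchedPDMP.act_mem_extremalProbs _ _ hQ hK hKQ hQK hν,
        hKQ (SwitchedPDMP.mem_extremalProbs_iff.1 hν).1⟩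
  · constructor
    · rintro ⟨ν, hν, huniq⟩
      refine ⟨_, hQ hν, fun μ hμ => ?_⟩
      rw [← hQK hμ, huniq _ (hK hμ)]
    · rintro ⟨μ, hμ, huniq⟩
      refine ⟨_, hK hμ, fun ν hν => ?_⟩
      rw [← hKQ hν, huniq _ (hQ hν)]
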